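/- Let $R$ be a commutative ring with unity of characteristic $0$ and let $G$ be an arbitrary group. Let $*$ be the classical involution of the group ring $RG$, given by $\left(\sum_{g\in G} r_g g\right)^* = \sum_{g\in G} r_g g^{-1}$, and let $RG^+=\{r\in RG : r^*=r\}$ be the set of symmetric elements. With $[a,b]=ab-ba$, say that $RG^+$ is Lie metabelian if $[[a,b],[c,d]]=0$ for all $a,b,c,d\in RG^+$. Then $RG^+$ is Lie metabelian if and only if at least one of the following conditions holds: 1. the subgroup $\langle g\in G : g^2\neq 1\rangle$ of $G$ generated by all elements $g$ with $g^2\ne 1$ is abelian; 2. $G$ contains an elementary abelian $2$-subgroup of index $2$ (that is, a subgroup $E$ of index $2$ with $e^2=1$ for all $e\in E$); 3. $G$ has an abelian subgroup $B$ of index $2$ and an element $x$ of order $4$ such that $x^{-1}bx=b^{-1}$ for every $b\in B$; 4. the center of $G$ is equal to $\{g\in G : g^2=1\}$ and has index $4$ in $G$. -/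

import Mathlib

/-- The classical involution `∑ r_g g ↦ ∑ r_g g⁻¹` of the group ring of `G` over `R`. -/
noncomputable def classicalInvolution (R G : Type*) [CommRing R] [Group G]
    (r : MonoidAlgebra R G) : MonoidAlgebra R G :=
  MonoidAlgebra.mapDomain (fun g : G => g⁻¹) r

/-- The set of symmetric elements of the group ring for the classical involution. -/
def symmetricElements (R G : Type*) [CommRing R] [Group G] : Set (MonoidAlgebra R G) :=
  {r | classicalInvolution R G r = r}

/-- A subset `X` of a ring is Lie metabelian if `[[a, b], [c, d]] = 0` for all
`a, b, c, d ∈ X`, where `[a, b] = a * b - b * a`. -/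
def IsLieMetabelian {A : Type*} [Ring A] (X : Set A) : Prop :=
  ∀ a ∈ X, ∀ b ∈ X, ∀ c ∈ X, ∀ d ∈ X, ⁅⁅a, b⁆, ⁅c, d⁆⁆ = 0

/-! ### The involution and the positive definite trace form on the integral group ring. -/

section ClassicalInvolution

variable {R G : Type*} [CommRing R] [Group G]

/-! Necessity. Characteristic 0 embeds ℤG in RG, so one may work over ℤ. There the form sending (x,
y) to the coefficient of x*y at 1 is positive definite, and `ad k` is self-adjoint or skew-adjoint
for k symmetric or skew; hence (ad k)² v = 0 forces [k, v] = 0 (`lie_eq_zero_of_lie_lie_eq_zero`).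
This sharpens the metabelian identity to j[s, v] = 0 for every v, whenever a symmetric s commutes
with a skew j (`skew_mul_lie`). With s = g + g⁻¹, j = g - g⁻¹ and v = h, comparing coefficients
shows that g is conjugate only to g and g⁻¹ if g⁴ ≠ 1, and that g² is central if g⁴ = 1.

If some g has g⁴ ≠ 1, its centralizer is abelian, of index at most 2, and inverted by any outside
element; this gives condition 1 or 3. Otherwise squares and commutators lie in the 𝔽₂-space V of
central involutions, and squaring is a quadratic map q with polar form c. Tested against a sign
character χ of V, the metabelian identity makes χ ∘ q vanish on whatever is orthogonal to a pair x,
y with χ(c x y) = 1 (`dual_sqClass_eq_zero_of_orthogonal`). So every alternating form χ ∘ c has rank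
at most 2 (`pluecker`). If G is not abelian, either some c x takes two distinct nonzero values,
which leads to condition 1, 2 or 3, or none does, which leads to 2 or 4.

Sufficiency. The symmetric elements are spanned by the g with g² = 1 and the g + g⁻¹, so it is
enough that commutators of these commute with each other. Under 1 and 3 these commutators are
supported on an abelian subgroup. Under 2 they are skew and supported off E, while their products
are supported on E, hence symmetric. Under 4 each is a group element times a central factor, and two
such either have commuting group parts or central factors with product 0. -/

theorem classicalInvolution_single (g : G) (r : R) :
    classicalInvolution R G (MonoidAlgebra.single g r) = MonoidAlgebra.single g⁻¹ r :=
  MonoidAlgebra.mapDomain_single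

theorem classicalInvolution_zero : classicalInvolution R G 0 = 0 :=
  MonoidAlgebra.mapDomain_zero _

theorem classicalInvolution_add (x y : MonoidAlgebra R G) :
    classicalInvolution R G (x + y) = classicalInvolution R G x + classicalInvolution R G y :=
  MonoidAlgebra.mapDomain_add _ _ _

theorem classicalInvolution_coeff (x : MonoidAlgebra R G) (g : G) :
    (classicalInvolution R G x).coeff g = x.coeff g⁻¹ := by
  have h := Finsupp.mapDomain_apply (M := R) (inv_injective (G := G)) x.coeff g⁻¹
  rwa [inv_inv] at h

theorem classicalInvolution_neg (x : MonoidAlgebra R G) :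
    classicalInvolution R G (-x) = -classicalInvolution R G x := by
  ext g; simp [classicalInvolution_coeff]

theorem classicalInvolution_sub (x y : MonoidAlgebra R G) :
    classicalInvolution R G (x - y) = classicalInvolution R G x - classicalInvolution R G y := by
  ext g; simp [classicalInvolution_coeff]

theorem classicalInvolution_smul (r : R) (x : MonoidAlgebra R G) :
    classicalInvolution R G (r • x) = r • classicalInvolution R G x := by
  ext g; simp [classicalInvolution_coeff]

theorem classicalInvolution_involutive (x : MonoidAlgebra R G) :
    classicalInvolution R G (classicalInvolution R G x) = x := by
  ext g; simp [classicalInvolution_coeff]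

theorem classicalInvolution_mul (x y : MonoidAlgebra R G) :
    classicalInvolution R G (x * y) = classicalInvolution R G y * classicalInvolution R G x := by
  induction x using MonoidAlgebra.induction_linear with
  | zero => simp [classicalInvolution_zero]
  | add a b ha hb => rw [add_mul, classicalInvolution_add, ha, hb, classicalInvolution_add, mul_add]
  | single g r =>
    induction y using MonoidAlgebra.induction_linear with
    | zero => simp [classicalInvolution_zero]
    | add a b ha hb =>
      rw [mul_add, classicalInvolution_add, ha, hb, classicalInvolution_add, add_mul]
    | single h s =>
      simp only [MonoidAlgebra.single_mul_single, classicalInvolution_single, mul_inv_rev, mul_comm]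

theorem mem_symmetricElements {x : MonoidAlgebra R G} :
    x ∈ symmetricElements R G ↔ classicalInvolution R G x = x := Iff.rfl

theorem coeff_one_mul_comm (x y : MonoidAlgebra R G) :
    (x * y).coeff 1 = (y * x).coeff 1 := by
  induction x using MonoidAlgebra.induction_linear with
  | zero => simp
  | add a b ha hb => simp [add_mul, mul_add, ha, hb]
  | single g r =>
    rw [MonoidAlgebra.coeff_single_mul_apply, MonoidAlgebra.coeff_mul_single_apply, mul_one, one_mul,
      mul_comm]

/-- The coefficient is the sum of the squares of the coefficients of x, and these are integers. -/
theorem eq_zero_of_coeff_one_involution_mul_self (x : MonoidAlgebra ℤ G)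
    (h : (classicalInvolution ℤ G x * x).coeff 1 = 0) : x = 0 := by
  have key : (classicalInvolution ℤ G x * x).coeff 1 = x.coeff.sum fun _ r => r * r := by
    rw [coeff_one_mul_comm, MonoidAlgebra.coeff_mul_apply_left]
    simp only [classicalInvolution_coeff, inv_inv, mul_one]
    exact Finsupp.sum_congr fun _ _ => rfl
  rw [key, Finsupp.sum, Finset.sum_eq_zero_iff_of_nonneg (fun _ _ => mul_self_nonneg _)] at h
  ext g
  by_contra hg
  have := h g (Finsupp.mem_support_iff.2 hg)
  simp_all

/-- An element of the integral group ring which is symmetric or skew-symmetric acts semisimply by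
the adjoint action. -/
theorem lie_eq_zero_of_lie_lie_eq_zero {k v : MonoidAlgebra ℤ G}
    (hk : classicalInvolution ℤ G k = k ∨ classicalInvolution ℤ G k = -k)
    (h : ⁅k, ⁅k, v⁆⁆ = 0) : ⁅k, v⁆ = 0 := by
  apply eq_zero_of_coeff_one_involution_mul_self
  set w := ⁅k, v⁆ with hw
  set v' := classicalInvolution ℤ G v
  -- Adjointness: by the trace property, the traces of [k, v]* w and v* [k, w] agree up to sign.
  have h0 : (v' * ⁅k, w⁆).coeff 1 = 0 := by rw [h]; simp
  rw [Ring.lie_def, mul_sub, MonoidAlgebra.coeff_sub, Finsupp.sub_apply, ← mul_assoc, ← mul_assoc,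
    coeff_one_mul_comm (v' * w) k, ← mul_assoc] at h0
  nth_rw 1 [hw]
  rw [Ring.lie_def, classicalInvolution_sub, classicalInvolution_mul, classicalInvolution_mul]
  rcases hk with hk | hk <;> rw [hk]
  · rw [sub_mul, MonoidAlgebra.coeff_sub, Finsupp.sub_apply]; exact h0
  · rw [sub_mul, MonoidAlgebra.coeff_sub, Finsupp.sub_apply]
    simp only [mul_neg, neg_mul, MonoidAlgebra.coeff_neg, Finsupp.neg_apply]
    change (v' * k * w).coeff 1 - _ = 0 at h0
    linarith

end ClassicalInvolution

/-! ### Consequences of the metabelian identity over ℤ for conjugation in G. -/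

section Integral

variable {G : Type*} [Group G]

theorem lie_mem_symmetric_of_skew {j u : MonoidAlgebra ℤ G}
    (hj : classicalInvolution ℤ G j = -j) (hu : classicalInvolution ℤ G u = u) :
    classicalInvolution ℤ G ⁅j, u⁆ = ⁅j, u⁆ := by
  rw [Ring.lie_def, classicalInvolution_sub, classicalInvolution_mul, classicalInvolution_mul, hj,
    hu]
  noncomm_ring

theorem lie_symmetric_skew {s u : MonoidAlgebra ℤ G}
    (hs : classicalInvolution ℤ G s = s) (hu : classicalInvolution ℤ G u = u) :
    classicalInvolution ℤ G ⁅s, u⁆ = -⁅s, u⁆ := by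
  rw [Ring.lie_def, classicalInvolution_sub, classicalInvolution_mul, classicalInvolution_mul, hs,
    hu]
  noncomm_ring

/-- Put k = [s, u]. Since `ad j` and `ad s` commute, [k, [j, k]] = [[s, u], [s, [j, u]]], a
metabelian expression in symmetric elements. So (ad k)² j = 0, and semisimplicity of `ad k`
finishes. -/
theorem lie_skew_lie_symmetric (hM : IsLieMetabelian (symmetricElements ℤ G))
    {s j u : MonoidAlgebra ℤ G} (hs : classicalInvolution ℤ G s = s)
    (hj : classicalInvolution ℤ G j = -j) (hsj : s * j = j * s)
    (hu : classicalInvolution ℤ G u = u) : ⁅j, ⁅s, u⁆⁆ = 0 := by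
  have hk := lie_symmetric_skew hs hu
  have h1 : ⁅j, ⁅s, u⁆⁆ = ⁅s, ⁅j, u⁆⁆ := by
    have : ⁅j, ⁅s, u⁆⁆ - ⁅s, ⁅j, u⁆⁆ = ⁅u, s * j - j * s⁆ := by
      simp only [Ring.lie_def]; noncomm_ring
    rw [← sub_eq_zero, this, hsj, sub_self, Ring.lie_def, mul_zero, zero_mul, sub_zero]
  have h2 : ⁅⁅s, u⁆, ⁅j, ⁅s, u⁆⁆⁆ = 0 := by
    rw [h1]; exact hM s hs u hu s hs _ (lie_mem_symmetric_of_skew hj hu)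
  have e : ∀ a b : MonoidAlgebra ℤ G, ⁅a, b⁆ = -⁅b, a⁆ := fun a b => by
    rw [Ring.lie_def, Ring.lie_def, neg_sub]
  rw [e, neg_eq_zero]
  apply lie_eq_zero_of_lie_lie_eq_zero (.inr hk)
  rw [e _ j, ← neg_eq_zero, ← h2]
  simp only [Ring.lie_def]; noncomm_ring

/-- The previous vanishing holds for the skew elements j and js; the Leibniz rule then leaves j[s,
[s, u]] = (ad s)²(ju) = 0, and `ad s` is semisimple. -/
theorem skew_mul_lie_symmetric (hM : IsLieMetabelian (symmetricElements ℤ G))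
    {s j u : MonoidAlgebra ℤ G} (hs : classicalInvolution ℤ G s = s)
    (hj : classicalInvolution ℤ G j = -j) (hsj : s * j = j * s)
    (hu : classicalInvolution ℤ G u = u) : j * ⁅s, u⁆ = 0 := by
  have h1 := lie_skew_lie_symmetric hM hs hj hsj hu
  have h2 := lie_skew_lie_symmetric hM (j := j * s) hs
    (by rw [classicalInvolution_mul, hs, hj, mul_neg, hsj]) (by rw [← mul_assoc, hsj]) hu
  have e : ∀ v, ⁅s, j * v⁆ = j * ⁅s, v⁆ := fun v => by
    rw [Ring.lie_def, Ring.lie_def, mul_sub, ← mul_assoc, hsj]; simp only [mul_assoc]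
  have h3 : j * ⁅s, ⁅s, u⁆⁆ = 0 := by
    have : ⁅j * s, ⁅s, u⁆⁆ = j * ⁅s, ⁅s, u⁆⁆ + ⁅j, ⁅s, u⁆⁆ * s := by
      simp only [Ring.lie_def]; noncomm_ring
    rw [h2, h1, zero_mul, add_zero] at this
    exact this.symm
  rw [← e]
  apply lie_eq_zero_of_lie_lie_eq_zero (.inl hs)
  rw [e, e, h3]

/-- Here [s, q] is symmetric, so the symmetric case gives (ad s)²(jq) = j[s, [s, q]] = 0. -/
theorem skew_mul_lie_skew (hM : IsLieMetabelian (symmetricElements ℤ G))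
    {s j q : MonoidAlgebra ℤ G} (hs : classicalInvolution ℤ G s = s)
    (hj : classicalInvolution ℤ G j = -j) (hsj : s * j = j * s)
    (hq : classicalInvolution ℤ G q = -q) : j * ⁅s, q⁆ = 0 := by
  have hu : classicalInvolution ℤ G ⁅s, q⁆ = ⁅s, q⁆ := by
    have : ⁅s, q⁆ = -⁅q, s⁆ := by rw [Ring.lie_def, Ring.lie_def, neg_sub]
    rw [this, classicalInvolution_neg, lie_mem_symmetric_of_skew hq hs]
  have e : ∀ v, ⁅s, j * v⁆ = j * ⁅s, v⁆ := fun v => by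
    rw [Ring.lie_def, Ring.lie_def, mul_sub, ← mul_assoc, hsj]; simp only [mul_assoc]
  rw [← e]
  apply lie_eq_zero_of_lie_lie_eq_zero (.inl hs)
  rw [e, e, skew_mul_lie_symmetric hM hs hj hsj hu]

/-- 2v is the sum of a symmetric and a skew element, and ℤG has no 2-torsion. -/
theorem skew_mul_lie (hM : IsLieMetabelian (symmetricElements ℤ G))
    {s j : MonoidAlgebra ℤ G} (hs : classicalInvolution ℤ G s = s)
    (hj : classicalInvolution ℤ G j = -j) (hsj : s * j = j * s) (v : MonoidAlgebra ℤ G) :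
    j * ⁅s, v⁆ = 0 := by
  have h1 := skew_mul_lie_symmetric hM hs hj hsj (u := v + classicalInvolution ℤ G v)
    (by rw [classicalInvolution_add, classicalInvolution_involutive, add_comm])
  have h2 := skew_mul_lie_skew hM hs hj hsj (q := v - classicalInvolution ℤ G v)
    (by rw [classicalInvolution_sub, classicalInvolution_involutive, neg_sub])
  have h3 : j * ⁅s, v⁆ + j * ⁅s, v⁆ = 0 := by
    have : j * ⁅s, v⁆ + j * ⁅s, v⁆ = j * ⁅s, v + classicalInvolution ℤ G v⁆ +
        j * ⁅s, v - classicalInvolution ℤ G v⁆ := by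
      simp only [Ring.lie_def]; noncomm_ring
    rw [this, h1, h2, add_zero]
  ext g
  have : (j * ⁅s, v⁆).coeff g + (j * ⁅s, v⁆).coeff g = 0 := by
    rw [← Finsupp.add_apply, ← MonoidAlgebra.coeff_add, h3]; rfl
  rw [MonoidAlgebra.coeff_zero, Finsupp.zero_apply]
  omega

/-- The vanishing of `(g - g⁻¹) * ⁅g + g⁻¹, h⁆`, with the negative terms moved to the right. -/
theorem single_sub_inv_mul_lie_add_inv (hM : IsLieMetabelian (symmetricElements ℤ G)) (g h : G) :
    (MonoidAlgebra.single (g ^ 2 * h) 1 + MonoidAlgebra.single (g⁻¹ * h * g) 1 +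
      MonoidAlgebra.single (g⁻¹ * h * g⁻¹) 1 : MonoidAlgebra ℤ G) =
    MonoidAlgebra.single (g * h * g) 1 + MonoidAlgebra.single (g * h * g⁻¹) 1 +
      MonoidAlgebra.single (g⁻¹ ^ 2 * h) 1 := by
  have := skew_mul_lie hM (s := .single g 1 + .single g⁻¹ 1) (j := .single g 1 - .single g⁻¹ 1)
    (by simp only [classicalInvolution_add, classicalInvolution_single, inv_inv, add_comm])
    (by simp only [classicalInvolution_sub, classicalInvolution_single, inv_inv, neg_sub])
    (by simp only [add_mul, mul_sub, mul_add, sub_mul, MonoidAlgebra.single_mul_single,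
          mul_inv_cancel, inv_mul_cancel]; abel)
    (.single h 1)
  simp only [Ring.lie_def, add_mul, mul_sub, mul_add, sub_mul, MonoidAlgebra.single_mul_single,
    mul_one, ← mul_assoc, mul_inv_cancel, inv_mul_cancel, one_mul] at this
  rw [← sub_eq_zero, ← this]
  simp only [pow_two]
  abel

/-- The term g²h on the left of the six-term identity must equal one on the right: ghg means h
centralizes g, ghg⁻¹ means h inverts g, and g⁻²h means g⁴ = 1. -/
theorem conj_eq_or_eq_inv (hM : IsLieMetabelian (symmetricElements ℤ G)) {g : G}
    (hg : g ^ 4 ≠ 1) (h : G) : h * g * h⁻¹ = g ∨ h * g * h⁻¹ = g⁻¹ := by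
  classical
  have := congrArg (fun y => y.coeff (g ^ 2 * h)) (single_sub_inv_mul_lie_add_inv hM g h)
  simp only [MonoidAlgebra.coeff_add, Finsupp.add_apply, MonoidAlgebra.coeff_single,
    Finsupp.single_apply] at this
  by_cases h1 : g * h * g = g ^ 2 * h
  · left
    rw [pow_two, mul_assoc, mul_assoc, mul_right_inj] at h1
    rw [h1, mul_inv_cancel_right]
  by_cases h2 : g * h * g⁻¹ = g ^ 2 * h
  · right
    rw [pow_two, mul_assoc, mul_assoc, mul_right_inj] at h2
    calc h * g * h⁻¹ = (h * g⁻¹ * h⁻¹)⁻¹ := by group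
      _ = g⁻¹ := by rw [h2, mul_inv_cancel_right]
  by_cases h3 : g⁻¹ ^ 2 * h = g ^ 2 * h
  · exfalso
    rw [mul_left_inj, inv_pow, inv_eq_iff_mul_eq_one, ← pow_add] at h3
    exact hg h3
  simp only [h1, h2, h3, if_true, if_false] at this
  split_ifs at this <;> omega

/-- Now g²h = g⁻²h cancels, so g⁻¹hg must equal ghg (then g² = 1) or ghg⁻¹ (then g² commutes with
h). -/
theorem sq_mul_comm_of_pow_four_eq_one (hM : IsLieMetabelian (symmetricElements ℤ G)) {g : G}
    (hg : g ^ 4 = 1) (h : G) : g ^ 2 * h = h * g ^ 2 := by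
  classical
  have h0 : g⁻¹ ^ 2 = g ^ 2 := by rw [inv_pow, inv_eq_iff_mul_eq_one, ← pow_add]; exact hg
  have := single_sub_inv_mul_lie_add_inv hM g h
  rw [h0] at this
  have := congrArg (fun y => y.coeff (g⁻¹ * h * g)) this
  simp only [MonoidAlgebra.coeff_add, Finsupp.add_apply, MonoidAlgebra.coeff_single,
    Finsupp.single_apply] at this
  by_cases h1 : g * h * g = g⁻¹ * h * g
  · rw [mul_left_inj, mul_left_inj, eq_comm, inv_eq_iff_mul_eq_one, ← pow_two] at h1
    rw [h1, one_mul, mul_one]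
  by_cases h2 : g * h * g⁻¹ = g⁻¹ * h * g
  · rw [mul_inv_eq_iff_eq_mul, mul_assoc, mul_assoc, eq_inv_mul_iff_mul_eq, ← mul_assoc, ← pow_two] at h2
    exact h2
  simp only [h1, h2, if_true, if_false] at this
  split_ifs at this <;> omega

end Integral

/-! ### Groups with an element whose fourth power is not 1. -/

section DichotomyOfConjugates

variable {G : Type*} [Group G]

theorem isMulCommutative_subgroup_iff {H : Subgroup G} :
    IsMulCommutative H ↔ ∀ a ∈ H, ∀ b ∈ H, a * b = b * a := by
  rw [isMulCommutative_iff]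
  exact ⟨fun h a ha b hb => congrArg Subtype.val (h ⟨a, ha⟩ ⟨b, hb⟩),
    fun h a b => Subtype.ext (h a a.2 b b.2)⟩

theorem isMulCommutative_closure_of_le {B : Subgroup G} (hB : IsMulCommutative B)
    (h : ∀ g : G, g ^ 2 ≠ 1 → g ∈ B) :
    IsMulCommutative (Subgroup.closure {g : G | g ^ 2 ≠ 1}) := by
  rw [isMulCommutative_subgroup_iff] at hB ⊢
  have hle : Subgroup.closure {g : G | g ^ 2 ≠ 1} ≤ B := (Subgroup.closure_le B).2 h
  exact fun a ha b hb => hB a (hle ha) b (hle hb)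

/-- A subgroup of index two that is commutative and inverted by an outer element gives one of the
two generalized dihedral or dicyclic configurations. -/
theorem closure_or_orderOf_four_of_inverted {B : Subgroup G} (hB : IsMulCommutative B)
    (hi : B.index = 2) {x : G} (hx : x ∉ B) (hinv : ∀ b ∈ B, x * b * x⁻¹ = b⁻¹) :
    IsMulCommutative (Subgroup.closure {g : G | g ^ 2 ≠ 1}) ∨
      ∃ B : Subgroup G, B.index = 2 ∧ IsMulCommutative B ∧
        ∃ x : G, orderOf x = 4 ∧ ∀ b ∈ B, x⁻¹ * b * x = b⁻¹ := by
  have hx2 : x * x ∈ B := Subgroup.mul_self_mem_of_index_two hi x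
  -- x both inverts and centralizes x².
  have hx4 : x ^ 4 = 1 := by
    have := hinv _ hx2
    rw [mul_assoc, mul_assoc, mul_inv_cancel, mul_one] at this
    rw [show x ^ 4 = x * x * (x * x) by simp [pow_succ, mul_assoc]]
    nth_rw 1 [this]
    group
  by_cases h2 : x ^ 2 = 1
  · left
    -- If g is outside B then x inverts xg; as x² = 1 this makes g an involution.
    refine isMulCommutative_closure_of_le hB fun g hg => ?_
    by_contra hgB
    apply hg
    have hxg : x * g ∈ B := (Subgroup.mul_mem_iff_of_index_two hi).2 (by simp [hx, hgB])
    have h1 := hinv _ hxg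
    have hxx : x * x = 1 := by rw [← pow_two, h2]
    rw [← mul_assoc, hxx, one_mul, mul_inv_rev, inv_eq_of_mul_eq_one_left hxx, mul_left_inj] at h1
    rw [pow_two]
    nth_rw 1 [h1]
    simp
  · right
    refine ⟨B, hi, hB, x, ?_, fun b hb => ?_⟩
    · exact orderOf_eq_prime_pow (p := 2) (n := 1) (by simpa using h2) (by simpa using hx4)
    · have := hinv _ (B.inv_mem hb)
      rw [inv_inv] at this
      nth_rw 1 [← this]
      group

/-- Suppose x moves h. If h⁴ = 1, then gh and g⁻¹h have fourth power ≠ 1, so x inverts both, and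
comparing gives g⁴ = 1. If h⁴ ≠ 1, x inverts h; then gh goes to gh⁻¹, which is excluded by `hB` or
by `hA` according to whether (gh)⁴ = 1. -/
theorem conj_eq_self_of_conj_eq_self
    (hA : ∀ g : G, g ^ 4 ≠ 1 → ∀ h, h * g * h⁻¹ = g ∨ h * g * h⁻¹ = g⁻¹)
    (hB : ∀ g : G, g ^ 4 = 1 → ∀ h, g ^ 2 * h = h * g ^ 2) {g h x : G} (hg : g ^ 4 ≠ 1)
    (hgh : Commute g h) (hx : x * g * x⁻¹ = g) : x * h * x⁻¹ = h := by
  by_contra hne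
  have hmul : ∀ a b, x * (a * b) * x⁻¹ = (x * a * x⁻¹) * (x * b * x⁻¹) := fun a b => by group
  by_cases h4 : h ^ 4 = 1
  · have e1 : (g * h) ^ 4 ≠ 1 := by rwa [hgh.mul_pow, h4, mul_one]
    have e2 : (g⁻¹ * h) ^ 4 ≠ 1 := by
      rwa [hgh.inv_left.mul_pow, h4, mul_one, inv_pow, ne_eq, inv_eq_one]
    have hx' : x * g⁻¹ * x⁻¹ = g⁻¹ := by nth_rw 2 [← hx]; group
    have f1 := hA _ e1 x
    have f2 := hA _ e2 x
    rw [hmul, hx, mul_right_inj] at f1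
    rw [hmul, hx', mul_right_inj] at f2
    have f1 := f1.resolve_left hne
    have f2 := f2.resolve_left hne
    replace f1 := eq_inv_mul_of_mul_eq f1
    replace f2 := eq_inv_mul_of_mul_eq f2
    rw [mul_inv_rev] at f1 f2
    rw [f1, inv_inv, ← hgh.inv_inv.eq, ← hgh.inv_right.eq, ← mul_assoc, ← mul_assoc,
      mul_left_inj] at f2
    apply hg
    rw [show g ^ 4 = g * g * (g * g) by simp [pow_succ, mul_assoc]]
    nth_rw 1 [← f2]
    group
  · have f := (hA _ h4 x).resolve_left hne
    by_cases e : (g * h) ^ 4 = 1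
    · have := mul_inv_eq_iff_eq_mul.2 (hB _ e x).symm
      rw [hgh.mul_pow, hmul, ← conj_pow, ← conj_pow, hx, f,
        mul_right_inj, inv_pow, inv_eq_iff_mul_eq_one, ← pow_add] at this
      exact h4 this
    · rcases hA _ e x with e | e
      · rw [hmul, hx, f, mul_right_inj] at e
        exact hne (f.trans e)
      · rw [hmul, hx, f, hgh.mul_inv, mul_left_inj, eq_inv_iff_mul_eq_one] at e
        exact hg (by rw [show g ^ 4 = g * g * (g * g) by simp [pow_succ, mul_assoc], e, one_mul])

/-- The same argument with the two alternatives exchanged: if x does not invert h, compare gh with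
g⁻¹h when h⁴ = 1, and otherwise follow gh, which goes to g⁻¹h. -/
theorem conj_eq_inv_of_conj_eq_inv
    (hA : ∀ g : G, g ^ 4 ≠ 1 → ∀ h, h * g * h⁻¹ = g ∨ h * g * h⁻¹ = g⁻¹)
    (hB : ∀ g : G, g ^ 4 = 1 → ∀ h, g ^ 2 * h = h * g ^ 2) {g h x : G} (hg : g ^ 4 ≠ 1)
    (hgh : Commute g h) (hx : x * g * x⁻¹ = g⁻¹) : x * h * x⁻¹ = h⁻¹ := by
  by_contra hne
  have hmul : ∀ a b, x * (a * b) * x⁻¹ = (x * a * x⁻¹) * (x * b * x⁻¹) := fun a b => by group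
  by_cases h4 : h ^ 4 = 1
  · have e1 : (g * h) ^ 4 ≠ 1 := by rwa [hgh.mul_pow, h4, mul_one]
    have e2 : (g⁻¹ * h) ^ 4 ≠ 1 := by
      rwa [hgh.inv_left.mul_pow, h4, mul_one, inv_pow, ne_eq, inv_eq_one]
    have hx' : x * g⁻¹ * x⁻¹ = g := by
      rw [show x * g⁻¹ * x⁻¹ = (x * g * x⁻¹)⁻¹ by group, hx, inv_inv]
    have f1 := hA _ e1 x
    have f2 := hA _ e2 x
    rw [hmul, hx, hgh.mul_inv, mul_right_inj] at f1
    rw [hmul, hx', hgh.inv_left.mul_inv, inv_inv, mul_right_inj] at f2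
    have f1 := f1.resolve_right hne
    have f2 := f2.resolve_right hne
    replace f1 := eq_inv_mul_of_mul_eq f1
    replace f2 := eq_inv_mul_of_mul_eq f2
    rw [f1, inv_inv, ← mul_assoc, ← mul_assoc, mul_left_inj] at f2
    apply hg
    rw [show g ^ 4 = g * g * (g * g) by simp [pow_succ, mul_assoc]]
    nth_rw 1 [f2]
    group
  · have f := (hA _ h4 x).resolve_right hne
    by_cases e : (g * h) ^ 4 = 1
    · have := mul_inv_eq_iff_eq_mul.2 (hB _ e x).symm
      rw [hgh.mul_pow, hmul, ← conj_pow, ← conj_pow, hx, f,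
        mul_left_inj, inv_pow, inv_eq_iff_mul_eq_one, ← pow_add] at this
      exact hg this
    · rcases hA _ e x with e | e
      · rw [hmul, hx, f, mul_left_inj, inv_eq_iff_mul_eq_one] at e
        exact hg (by rw [show g ^ 4 = g * g * (g * g) by simp [pow_succ, mul_assoc], e, one_mul])
      · rw [hmul, hx, f, hgh.mul_inv, mul_right_inj] at e
        exact hne (f.trans e)

/-- The centralizer of g is abelian, and every element outside it inverts g, hence inverts the whole
centralizer; a product of two outside elements fixes g, so the index is at most 2. -/
theorem closure_or_orderOf_four_of_pow_four_ne_one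
    (hA : ∀ g : G, g ^ 4 ≠ 1 → ∀ h, h * g * h⁻¹ = g ∨ h * g * h⁻¹ = g⁻¹)
    (hB : ∀ g : G, g ^ 4 = 1 → ∀ h, g ^ 2 * h = h * g ^ 2) {g : G} (hg : g ^ 4 ≠ 1) :
    IsMulCommutative (Subgroup.closure {g : G | g ^ 2 ≠ 1}) ∨
      ∃ B : Subgroup G, B.index = 2 ∧ IsMulCommutative B ∧
        ∃ x : G, orderOf x = 4 ∧ ∀ b ∈ B, x⁻¹ * b * x = b⁻¹ := by
  set B := Subgroup.centralizer {g} with hBdef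
  have hmem : ∀ h, h ∈ B ↔ h * g * h⁻¹ = g := fun h => by
    rw [hBdef, Subgroup.mem_centralizer_singleton_iff, mul_inv_eq_iff_eq_mul]
  have hcomm : ∀ h ∈ B, Commute g h := fun h hh =>
    (mul_inv_eq_iff_eq_mul.1 ((hmem h).1 hh)).symm
  have comm : IsMulCommutative B := isMulCommutative_subgroup_iff.2 fun h hh k hk =>
    (mul_inv_eq_iff_eq_mul.1 (conj_eq_self_of_conj_eq_self hA hB hg (hcomm k hk) ((hmem h).1 hh)))
  by_cases hall : ∀ x, x ∈ B
  · exact .inl (isMulCommutative_closure_of_le comm fun x _ => hall x)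
  push Not at hall
  obtain ⟨x, hx⟩ := hall
  have hout : ∀ y, y ∉ B → y * g * y⁻¹ = g⁻¹ := fun y hy =>
    (hA g hg y).resolve_left fun h => hy ((hmem y).2 h)
  have hi : B.index = 2 := Subgroup.index_eq_two_iff_exists_notMem_and'.2 ⟨x, hx, fun y => by
    by_cases hy : y ∈ B
    · exact .inr hy
    · left
      rw [hmem]
      calc x * y * g * (x * y)⁻¹ = x * (y * g * y⁻¹) * x⁻¹ := by group
        _ = (x * g * x⁻¹)⁻¹ := by rw [hout y hy]; group
        _ = g := by rw [hout x hx, inv_inv]⟩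
  exact closure_or_orderOf_four_of_inverted comm hi hx fun b hb =>
    conj_eq_inv_of_conj_eq_inv hA hB hg (hcomm b hb) (hout x hx)

end DichotomyOfConjugates

/-! ### Separating vectors by functionals over 𝔽₂. -/

section ZModTwoDual

variable {V : Type*} [AddCommGroup V] [Module (ZMod 2) V]

theorem zmod_two_eq_zero_or_one (a : ZMod 2) : a = 0 ∨ a = 1 := by
  revert a; decide

theorem add_self_eq_zero_of_zmod_two (v : V) : v + v = 0 := by
  rw [← two_smul (ZMod 2) v, show (2 : ZMod 2) = 0 from rfl, zero_smul]

theorem add_eq_zero_iff_eq_of_zmod_two {v w : V} : v + w = 0 ↔ v = w := by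
  rw [← add_self_eq_zero_of_zmod_two w, add_left_inj]

theorem exists_dual_eq_one_of_notMem_pair {s t p : V} (h0 : p ≠ 0) (hs : p ≠ s) (ht : p ≠ t)
    (hst : p ≠ s + t) :
    ∃ χ : V →ₗ[ZMod 2] ZMod 2, χ p = 1 ∧ χ s = 0 ∧ χ t = 0 := by
  have hp : p ∉ Submodule.span (ZMod 2) {s, t} := by
    rw [Submodule.mem_span_pair]
    rintro ⟨a, b, hab⟩
    rcases zmod_two_eq_zero_or_one a with rfl | rfl <;>
      rcases zmod_two_eq_zero_or_one b with rfl | rfl <;> simp at hab <;> simp_all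
  obtain ⟨χ, hχ, hle⟩ := Submodule.exists_le_ker_of_notMem hp
  exact ⟨χ, (zmod_two_eq_zero_or_one _).resolve_left hχ,
    hle (Submodule.subset_span (by simp)), hle (Submodule.subset_span (by simp))⟩

theorem exists_dual_eq_one_eq_one {s u v : V} (hu : u ≠ 0) (hus : u ≠ s) (hv : v ≠ 0)
    (hvs : v ≠ s) : ∃ χ : V →ₗ[ZMod 2] ZMod 2, χ u = 1 ∧ χ v = 1 ∧ χ s = 0 := by
  obtain ⟨χ, hχu, hχs, -⟩ := exists_dual_eq_one_of_notMem_pair hu hus hu (by simpa using hus)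
  obtain ⟨ψ, hψv, hψs, -⟩ := exists_dual_eq_one_of_notMem_pair hv hvs hv (by simpa using hvs)
  rcases zmod_two_eq_zero_or_one (χ v) with h1 | h1
  · rcases zmod_two_eq_zero_or_one (ψ u) with h2 | h2
    · exact ⟨χ + ψ, by simp [*], by simp [*], by simp [*]⟩
    · exact ⟨ψ, h2, hψv, hψs⟩
  · exact ⟨χ, hχu, h1, hχs⟩

theorem eq_zero_of_forall_dual_mul_eq_zero {s v : V} (hs : s ≠ 0)
    (h : ∀ χ : V →ₗ[ZMod 2] ZMod 2, χ s * χ v = 0) : v = 0 := by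
  by_contra hv
  obtain ⟨χ, h1, h2, -⟩ := exists_dual_eq_one_eq_one (s := 0) hs hs hv hv
  simpa [h1, h2] using h χ

end ZModTwoDual

/-- The squaring map `q` and the commutator map `c` of a group in which squares and commutators
form a central elementary abelian 2-group `V`, subject to the condition `quad` that every quadratic
form `χ ∘ q` with nonzero polar form vanishes on the orthogonal of a hyperbolic pair. -/
structure SquareCommutatorForm (G V : Type*) [Group G] [AddCommGroup V] [Module (ZMod 2) V] where
  q : G → V
  c : G → G → V
  c_mul_right : ∀ x y z, c x (y * z) = c x y + c x z
  c_comm : ∀ x y, c x y = c y x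
  c_eq_zero : ∀ x y, c x y = 0 ↔ x * y = y * x
  q_mul : ∀ x y, q (x * y) = q x + q y + c x y
  q_eq_zero : ∀ x, q x = 0 ↔ x ^ 2 = 1
  conj_eq_inv : ∀ x y, q y = c x y → x * y * x⁻¹ = y⁻¹
  quad : ∀ (χ : V →ₗ[ZMod 2] ZMod 2) x y g, χ (c x y) = 1 → χ (c x g) = 0 → χ (c y g) = 0 →
    χ (q g) = 0

/-! ### Rank-two alternating forms: Plücker and cubic relations. -/

namespace SquareCommutatorForm

variable {G V : Type*} [Group G] [AddCommGroup V] [Module (ZMod 2) V]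
  (F : SquareCommutatorForm G V)

theorem c_mul_left (x y z : G) : F.c (x * y) z = F.c x z + F.c y z := by
  rw [F.c_comm, F.c_mul_right, F.c_comm z, F.c_comm z]

theorem c_self (x : G) : F.c x x = 0 := (F.c_eq_zero x x).2 rfl

/-- Polarize `quad`: χ ∘ q vanishes on g, h and gh. Thus the complement of a hyperbolic pair is
totally isotropic and χ ∘ c has rank at most 2. -/
theorem dual_c_eq_zero_of_orthogonal {χ : V →ₗ[ZMod 2] ZMod 2} {x y g h : G}
    (hxy : χ (F.c x y) = 1) (hxg : χ (F.c x g) = 0) (hyg : χ (F.c y g) = 0)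
    (hxh : χ (F.c x h) = 0) (hyh : χ (F.c y h) = 0) : χ (F.c g h) = 0 := by
  have h1 := F.quad χ x y g hxy hxg hyg
  have h2 := F.quad χ x y h hxy hxh hyh
  have h3 := F.quad χ x y (g * h) hxy (by rw [F.c_mul_right, map_add, hxg, hxh, add_zero])
    (by rw [F.c_mul_right, map_add, hyg, hyh, add_zero])
  rwa [F.q_mul, map_add, map_add, h1, h2, add_zero, zero_add] at h3

theorem dual_c_pow_val (χ : V →ₗ[ZMod 2] ZMod 2) (a : ZMod 2) (x y : G) :
    χ (F.c (x ^ a.val) y) = a * χ (F.c x y) := by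
  rcases zmod_two_eq_zero_or_one a with rfl | rfl
  · simp [(F.c_eq_zero 1 y).2 (by simp)]
  · simp [ZMod.val_one]

/-- Orthogonal projection off the hyperbolic pair; exponents are the coordinates of g, lifted from
`ZMod 2`. -/
theorem exists_orthogonal {χ : V →ₗ[ZMod 2] ZMod 2} {x y : G} (hxy : χ (F.c x y) = 1) (g : G) :
    ∃ g' : G, χ (F.c x g') = 0 ∧ χ (F.c y g') = 0 ∧ ∀ k, χ (F.c g' k) =
      χ (F.c g k) + χ (F.c y g) * χ (F.c x k) + χ (F.c x g) * χ (F.c y k) := by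
  have key : ∀ k, χ (F.c (g * x ^ (χ (F.c y g)).val * y ^ (χ (F.c x g)).val) k) =
      χ (F.c g k) + χ (F.c y g) * χ (F.c x k) + χ (F.c x g) * χ (F.c y k) := fun k => by
    simp only [F.c_mul_left, map_add, F.dual_c_pow_val]
  refine ⟨_, ?_, ?_, key⟩
  · rw [F.c_comm, key, F.c_self, F.c_comm y x, hxy, F.c_comm g x]
    simp [CharTwo.add_self_eq_zero]
  · rw [F.c_comm, key, F.c_self, hxy, F.c_comm g y]
    simp [CharTwo.add_self_eq_zero]

theorem pluecker_of_eq_one {χ : V →ₗ[ZMod 2] ZMod 2} {x y : G} (hxy : χ (F.c x y) = 1) (g h : G) :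
    χ (F.c x y) * χ (F.c g h) + χ (F.c x g) * χ (F.c y h) + χ (F.c x h) * χ (F.c y g) = 0 := by
  obtain ⟨g', hg1, hg2, hg⟩ := F.exists_orthogonal hxy g
  obtain ⟨h', hh1, hh2, hh⟩ := F.exists_orthogonal hxy h
  have := F.dual_c_eq_zero_of_orthogonal hxy hg1 hg2 hh1 hh2
  rw [hg, hh1, hh2, F.c_comm g h', hh, F.c_comm h g] at this
  rw [hxy, ← this]
  ring

theorem pluecker (χ : V →ₗ[ZMod 2] ZMod 2) (x y g h : G) :
    χ (F.c x y) * χ (F.c g h) + χ (F.c x g) * χ (F.c y h) + χ (F.c x h) * χ (F.c y g) = 0 := by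
  rcases zmod_two_eq_zero_or_one (χ (F.c x y)) with h1 | h1
  · rcases zmod_two_eq_zero_or_one (χ (F.c x g)) with h2 | h2
    · rcases zmod_two_eq_zero_or_one (χ (F.c x h)) with h3 | h3
      · simp [h1, h2, h3]
      · rw [← F.pluecker_of_eq_one h3 g y, F.c_comm g y, F.c_comm h y, F.c_comm h g]; ring
    · rw [← F.pluecker_of_eq_one h2 y h, F.c_comm g h, F.c_comm g y, F.c_comm h g]; ring
  · exact F.pluecker_of_eq_one h1 g h

/-- This is χ(q z') = 0 expanded, for z' the projection of z off the pair x, y. -/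
theorem cubic_of_eq_one {χ : V →ₗ[ZMod 2] ZMod 2} {x y : G} (hxy : χ (F.c x y) = 1) (z : G) :
    χ (F.c x y) * χ (F.q z) + χ (F.c y z) * χ (F.q x) + χ (F.c x z) * χ (F.q y) +
      χ (F.c x y) * χ (F.c x z) * χ (F.c y z) = 0 := by
  have hyx : χ (F.c y x) = 1 := by rw [F.c_comm, hxy]
  have e11 : (1 : ZMod 2) + 1 = 0 := rfl
  rcases zmod_two_eq_zero_or_one (χ (F.c x z)) with h1 | h1 <;>
    rcases zmod_two_eq_zero_or_one (χ (F.c y z)) with h2 | h2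
  · have := F.quad χ x y z hxy h1 h2
    simp [*]
  · have := F.quad χ x y (z * x) hxy (by simp [F.c_mul_right, F.c_self, *])
      (by simp [F.c_mul_right, *])
    simpa [F.q_mul, F.c_comm z x, *] using this
  · have := F.quad χ x y (z * y) hxy (by simp [F.c_mul_right, *])
      (by simp [F.c_mul_right, F.c_self, *])
    simpa [F.q_mul, F.c_comm z y, *] using this
  · have := F.quad χ x y (z * x * y) hxy (by simp [F.c_mul_right, F.c_self, *])
      (by simp [F.c_mul_right, F.c_self, *])
    simp only [F.q_mul, F.c_mul_left, map_add, F.c_comm z x, F.c_comm z y, h1, h2, hxy] at this ⊢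
    linear_combination this - e11

theorem cubic (χ : V →ₗ[ZMod 2] ZMod 2) (x y z : G) :
    χ (F.c x y) * χ (F.q z) + χ (F.c y z) * χ (F.q x) + χ (F.c x z) * χ (F.q y) +
      χ (F.c x y) * χ (F.c x z) * χ (F.c y z) = 0 := by
  rcases zmod_two_eq_zero_or_one (χ (F.c x y)) with h1 | h1
  · rcases zmod_two_eq_zero_or_one (χ (F.c x z)) with h2 | h2
    · rcases zmod_two_eq_zero_or_one (χ (F.c y z)) with h3 | h3
      · simp [h1, h2, h3]
      · rw [← F.cubic_of_eq_one h3 x, F.c_comm z x, F.c_comm y x]; ring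
    · rw [← F.cubic_of_eq_one h2 y, F.c_comm z y]; ring
  · exact F.cubic_of_eq_one h1 z

/-- The commutators of three elements are linearly dependent. -/
theorem c_mem_span_pair (x y z : G) (hs : F.c x y ≠ 0) (ht : F.c x z ≠ 0)
    (hst : F.c x z ≠ F.c x y) : F.c y z = 0 ∨ F.c y z = F.c x y ∨ F.c y z = F.c x z ∨
      F.c y z = F.c x y + F.c x z := by
  by_contra! hp
  obtain ⟨hp0, hps, hpt, hpst⟩ := hp
  have cubic := fun χ => F.cubic χ x y z
  generalize F.c x y = s at *
  generalize F.c x z = t at *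
  generalize F.c y z = p at *
  have hsp : t ≠ s + p := by
    rintro rfl; apply hpst; rw [← add_assoc, add_self_eq_zero_of_zmod_two, zero_add]
  have htp : s ≠ t + p := by
    rintro rfl
    apply hpst; rw [add_right_comm, add_self_eq_zero_of_zmod_two, zero_add]
  -- Take the basis dual to s, t, p. The cubic relation has terms of degrees 2 and 3 in χ; its third
  -- difference kills the former and turns χ(s)χ(t)χ(p) into 1, so 1 = 0.
  obtain ⟨χ, a1, a2, a3⟩ := exists_dual_eq_one_of_notMem_pair hs hst.symm hps.symm htp
  obtain ⟨ψ, b1, b2, b3⟩ := exists_dual_eq_one_of_notMem_pair ht hst hpt.symm hsp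
  obtain ⟨θ, c1, c2, c3⟩ := exists_dual_eq_one_of_notMem_pair hp0 hps hpt hpst
  have e1 := cubic χ
  have e2 := cubic ψ
  have e3 := cubic θ
  have e4 := cubic (χ + ψ)
  have e5 := cubic (χ + θ)
  have e6 := cubic (ψ + θ)
  have e7 := cubic (χ + ψ + θ)
  simp only [LinearMap.add_apply, a1, a2, a3, b1, b2, b3, c1, c2, c3, one_mul, zero_mul, mul_zero,
    add_zero, zero_add, mul_one] at e1 e2 e3 e4 e5 e6 e7
  simp only [e1, e2, e3, add_zero, zero_add] at e4 e5 e6 e7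
  have h10 : (1 : ZMod 2) = 0 := by linear_combination e7 - e4 - e5 - e6
  exact one_ne_zero h10

/-- Otherwise one χ is 1 on both c x y and q z, against `quad`. -/
theorem q_center_eq_zero {x y : G} (hxy : F.c x y ≠ 0) {z : G} (hz : ∀ g, F.c g z = 0) :
    F.q z = 0 := by
  by_contra h
  obtain ⟨χ, h1, h2, -⟩ := exists_dual_eq_one_eq_one (s := 0) hxy hxy h h
  have := F.quad χ x y z h1 (by rw [hz, map_zero]) (by rw [hz, map_zero])
  simp [h2] at this

end SquareCommutatorForm

/-! ### From the form to the group alternatives. -/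

namespace SquareCommutatorForm

variable {G V : Type*} [Group G] [AddCommGroup V] [Module (ZMod 2) V]
  (F : SquareCommutatorForm G V)

theorem mem_center_iff_c {z : G} : z ∈ Subgroup.center G ↔ ∀ g, F.c g z = 0 := by
  simp only [Subgroup.mem_center_iff, F.c_eq_zero]

theorem mem_centralizer_iff_c {y g : G} : g ∈ Subgroup.centralizer {y} ↔ F.c y g = 0 := by
  rw [Subgroup.mem_centralizer_singleton_iff, F.c_eq_zero, eq_comm]

/-- If `c x` takes two independent values, then it does so on a commuting pair. -/
theorem exists_commuting {x y z : G} (hs : F.c x y ≠ 0) (ht : F.c x z ≠ 0)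
    (hst : F.c x z ≠ F.c x y) : ∃ y' z', F.c x y' ≠ 0 ∧ F.c x z' ≠ 0 ∧ F.c x z' ≠ F.c x y' ∧
      F.c y' z' = 0 := by
  -- Multiplying y or z by x keeps the values of c x but shifts c y z by c x z or c x y.
  have hyx : ∀ g, F.c x (g * x) = F.c x g := fun g => by
    rw [F.c_mul_right, F.c_self, add_zero]
  rcases F.c_mem_span_pair x y z hs ht hst with h | h | h | h
  · exact ⟨y, z, hs, ht, hst, h⟩
  · refine ⟨y, z * x, hs, by rwa [hyx], by rwa [hyx], ?_⟩
    rw [F.c_mul_right, h, F.c_comm y, add_self_eq_zero_of_zmod_two]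
  · refine ⟨y * x, z, by rwa [hyx], ht, by rwa [hyx], ?_⟩
    rw [F.c_mul_left, h, add_self_eq_zero_of_zmod_two]
  · refine ⟨y * x, z * x, by rwa [hyx], by rwa [hyx], by rwa [hyx, hyx], ?_⟩
    rw [F.c_mul_left, hyx, F.c_mul_right, h, F.c_comm y x, add_assoc (F.c x y + F.c x z),
      add_self_eq_zero_of_zmod_two]

/-- Plücker gives χ(c x y)χ(c z g) = χ(c x z)χ(c y g) for all χ; as c x y and c x z are independent,
(c y g, c z g) is an 𝔽₂-multiple of (c x y, c x z). -/
theorem c_eq_zero_or_eq {x y z : G} (hs : F.c x y ≠ 0) (ht : F.c x z ≠ 0)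
    (hst : F.c x z ≠ F.c x y) (hyz : F.c y z = 0) (g : G) :
    F.c y g = 0 ∧ F.c z g = 0 ∨ F.c y g = F.c x y ∧ F.c z g = F.c x z := by
  have P : ∀ χ : V →ₗ[ZMod 2] ZMod 2,
      χ (F.c x y) * χ (F.c z g) + χ (F.c x z) * χ (F.c y g) = 0 := fun χ => by
    simpa [hyz] using F.pluecker χ x y z g
  have hu : F.c y g = 0 ∨ F.c y g = F.c x y := by
    by_contra! hu
    obtain ⟨χ, h1, h2, h3⟩ := exists_dual_eq_one_eq_one hu.1 hu.2 ht hst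
    simpa [h1, h2, h3] using P χ
  rcases hu with hu | hu
  · exact .inl ⟨hu, eq_zero_of_forall_dual_mul_eq_zero hs fun χ => by simpa [hu] using P χ⟩
  · refine .inr ⟨hu, add_eq_zero_iff_eq_of_zmod_two.1
      (eq_zero_of_forall_dual_mul_eq_zero hs fun χ => ?_)⟩
    have := P χ
    rw [hu] at this
    rw [map_add, ← this]
    ring

/-- The centralizer B of y is abelian of index 2, and on it q b is 0 or c x b. Translating by y
makes the choice uniform: either q = 0 on B, so B is elementary, or q = c x on B, so x inverts B. -/
theorem closure_or_elementary_or_orderOf_four {x y z : G} (hs : F.c x y ≠ 0) (ht : F.c x z ≠ 0)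
    (hst : F.c x z ≠ F.c x y) (hyz : F.c y z = 0) :
    IsMulCommutative (Subgroup.closure {g : G | g ^ 2 ≠ 1}) ∨
      (∃ E : Subgroup G, E.index = 2 ∧ IsMulCommutative E ∧ ∀ e ∈ E, e ^ 2 = 1) ∨
      (∃ B : Subgroup G, B.index = 2 ∧ IsMulCommutative B ∧
        ∃ x : G, orderOf x = 4 ∧ ∀ b ∈ B, x⁻¹ * b * x = b⁻¹) := by
  have D := F.c_eq_zero_or_eq hs ht hst hyz
  set B := Subgroup.centralizer {y} with hB
  have hmem : ∀ g, g ∈ B ↔ F.c y g = 0 := fun g => F.mem_centralizer_iff_c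
  have hmemz : ∀ g ∈ B, F.c z g = 0 := fun g hg => by
    rcases D g with h | h
    · exact h.2
    · exact absurd (h.1.symm.trans ((hmem g).1 hg)) hs
  have hxB : x ∉ B := fun h => hs (by rw [F.c_comm]; exact (hmem x).1 h)
  have hi : B.index = 2 := Subgroup.index_eq_two_iff_exists_notMem_and'.2 ⟨x, hxB, fun g => by
    rw [hmem, hmem, F.c_mul_right, F.c_comm y x]
    rcases D g with h | h
    · exact .inr h.1
    · rw [h.1]; exact .inl (add_self_eq_zero_of_zmod_two _)⟩
  have hcomm : ∀ g ∈ B, ∀ h ∈ B, F.c g h = 0 := fun g hg h hh =>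
    eq_zero_of_forall_dual_mul_eq_zero hs fun χ => by
      simpa [(hmem g).1 hg, (hmem h).1 hh] using F.pluecker χ x y g h
  have hBc : IsMulCommutative B := isMulCommutative_subgroup_iff.2 fun g hg h hh =>
    (F.c_eq_zero g h).1 (hcomm g hg h hh)
  have hyB : y ∈ B := (hmem y).2 (F.c_self y)
  -- Otherwise some χ kills c x b but is 1 on q b and on c x y (on c x z if c x y = c x b),
  -- contradicting `quad`.
  have hq : ∀ b ∈ B, F.q b = 0 ∨ F.q b = F.c x b := fun b hb => by
    by_contra! hne
    by_cases hsw : F.c x y = F.c x b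
    · obtain ⟨χ, h1, h2, h3⟩ := exists_dual_eq_one_eq_one hne.1 hne.2 ht (hsw ▸ hst)
      have := F.quad χ x z b h2 h3 (by rw [hmemz b hb, map_zero])
      simp [h1] at this
    · obtain ⟨χ, h1, h2, h3⟩ := exists_dual_eq_one_eq_one hne.1 hne.2 hs hsw
      have := F.quad χ x y b h2 h3 (by rw [(hmem b).1 hb, map_zero])
      simp [h1] at this
  have hqy : ∀ b ∈ B, F.q (y * b) = F.q y + F.q b := fun b hb => by
    rw [F.q_mul, (hmem b).1 hb, add_zero]
  rcases hq y hyB with h0 | h1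
  · refine .inr (.inl ⟨B, hi, hBc, fun b hb => (F.q_eq_zero b).1 ?_⟩)
    by_contra hne
    have hb1 := (hq b hb).resolve_left hne
    have h2 := hq _ (B.mul_mem hyB hb)
    rw [hqy b hb, h0, zero_add, F.c_mul_right, ← hb1, right_eq_add] at h2
    exact h2.elim hne hs
  · have hall : ∀ b ∈ B, F.q b = F.c x b := fun b hb => by
      by_contra hne
      have hb0 := (hq b hb).resolve_right hne
      have h2 := hq _ (B.mul_mem hyB hb)
      rw [hqy b hb, h1, hb0, add_zero, F.c_mul_right, left_eq_add] at h2
      rcases h2 with h2 | h2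
      · exact hs h2
      · exact hne (hb0.trans h2.symm)
    rcases closure_or_orderOf_four_of_inverted hBc hi hxB
      fun b hb => F.conj_eq_inv x b (hall b hb) with h | h
    · exact .inl h
    · exact .inr (.inr h)

/-- Anything orthogonal to x and y is central. A noncentral involution e has an elementary abelian
centralizer of index 2; if there is none, the involutions are central and G modulo its center is
𝔽₂². -/
theorem elementary_or_center {x y : G} (hxy : F.c x y ≠ 0)
    (hrank : ∀ x y z, F.c x y ≠ 0 → F.c x z = 0 ∨ F.c x z = F.c x y) :
    (∃ E : Subgroup G, E.index = 2 ∧ IsMulCommutative E ∧ ∀ e ∈ E, e ^ 2 = 1) ∨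
      ((Subgroup.center G : Set G) = {g : G | g ^ 2 = 1} ∧ (Subgroup.center G).index = 4) := by
  have hcenter : ∀ x y, F.c x y ≠ 0 → ∀ w, F.c x w = 0 → F.c y w = 0 → ∀ g, F.c g w = 0 :=
    fun x y hxy w h1 h2 g => eq_zero_of_forall_dual_mul_eq_zero hxy fun χ => by
      simpa [h1, h2] using F.pluecker χ x y g w
  by_cases hE : ∃ e, F.q e = 0 ∧ ∃ g, F.c e g ≠ 0
  · left
    obtain ⟨e, he, g, heg⟩ := hE
    have hmem : ∀ b, b ∈ Subgroup.centralizer {e} ↔ F.c e b = 0 := fun b =>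
      F.mem_centralizer_iff_c
    -- Either b or eb is orthogonal to e and g, hence central, and both have the same square.
    have hq : ∀ b ∈ Subgroup.centralizer {e}, F.q b = 0 := fun b hb => by
      rw [hmem] at hb
      by_cases hgb : F.c g b = 0
      · exact F.q_center_eq_zero heg (hcenter e g heg b hb hgb)
      · have h1 : F.c g b = F.c g e :=
          (hrank g e b (by rwa [F.c_comm])).resolve_left hgb
        have h2 := F.q_center_eq_zero heg (hcenter e g heg (e * b)
          (by rw [F.c_mul_right, F.c_self, hb, add_zero])
          (by rw [F.c_mul_right, h1, add_self_eq_zero_of_zmod_two]))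
        rwa [F.q_mul, he, hb, add_zero, zero_add] at h2
    refine ⟨Subgroup.centralizer {e}, ?_, ?_, fun b hb => (F.q_eq_zero b).1 (hq b hb)⟩
    · refine Subgroup.index_eq_two_iff_exists_notMem_and'.2 ⟨g, fun h => heg ((hmem g).1 h),
        fun b => ?_⟩
      rw [hmem, hmem, F.c_mul_right]
      rcases hrank e g b heg with h | h
      · exact .inr h
      · rw [h]; exact .inl (add_self_eq_zero_of_zmod_two _)
    · refine isMulCommutative_subgroup_iff.2 fun a ha b hb => (F.c_eq_zero a b).1 ?_
      have := hq _ (mul_mem ha hb)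
      rwa [F.q_mul, hq a ha, hq b hb, add_zero, zero_add] at this
  · right
    push Not at hE
    constructor
    · ext g
      rw [SetLike.mem_coe, F.mem_center_iff_c, Set.mem_ofPred_eq, ← F.q_eq_zero]
      exact ⟨fun h => F.q_center_eq_zero hxy h, fun h k => by rw [F.c_comm]; exact hE g h k⟩
    · obtain ⟨χ, hχ, -, -⟩ := exists_dual_eq_one_eq_one (s := 0) hxy hxy hxy hxy
      let f : G →* Multiplicative (ZMod 2 × ZMod 2) :=
        { toFun := fun g => Multiplicative.ofAdd (χ (F.c x g), χ (F.c y g))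
          map_one' := by simp [(F.c_eq_zero _ 1).2]
          map_mul' := fun a b => by simp only [F.c_mul_right, map_add]; rfl }
      have hf : ∀ g, f g = Multiplicative.ofAdd (χ (F.c x g), χ (F.c y g)) := fun _ => rfl
      have hker : f.ker = Subgroup.center G := by
        ext g
        rw [MonoidHom.mem_ker, F.mem_center_iff_c, hf, ofAdd_eq_one, Prod.mk_eq_zero]
        constructor
        · rintro ⟨h1, h2⟩
          refine hcenter x y hxy g ?_ ?_
          · refine (hrank x y g hxy).resolve_right fun h => ?_
            rw [h, hχ] at h1
            exact one_ne_zero h1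
          · refine (hrank y x g (by rwa [F.c_comm])).resolve_right fun h => ?_
            rw [h, F.c_comm, hχ] at h2
            exact one_ne_zero h2
        · intro h
          rw [h, h, map_zero]
          exact ⟨rfl, rfl⟩
      have hsurj : Function.Surjective f := by
        have hx : f x = Multiplicative.ofAdd (0, 1) := by
          rw [hf, F.c_self, F.c_comm y, hχ, map_zero]
        have hy : f y = Multiplicative.ofAdd (1, 0) := by rw [hf, F.c_self, hχ, map_zero]
        intro v
        obtain ⟨a, b⟩ := v
        rcases zmod_two_eq_zero_or_one a with rfl | rfl <;>
          rcases zmod_two_eq_zero_or_one b with rfl | rfl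
        · exact ⟨1, map_one f⟩
        · exact ⟨x, hx⟩
        · exact ⟨y, hy⟩
        · exact ⟨y * x, by rw [map_mul, hx, hy]; rfl⟩
      rw [← hker, Subgroup.index_ker, MonoidHom.range_eq_top.2 hsurj]
      simp

theorem classification (F : SquareCommutatorForm G V) :
    IsMulCommutative (Subgroup.closure {g : G | g ^ 2 ≠ 1}) ∨
      (∃ E : Subgroup G, E.index = 2 ∧ IsMulCommutative E ∧ ∀ e ∈ E, e ^ 2 = 1) ∨
      (∃ B : Subgroup G, B.index = 2 ∧ IsMulCommutative B ∧
        ∃ x : G, orderOf x = 4 ∧ ∀ b ∈ B, x⁻¹ * b * x = b⁻¹) ∨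
      ((Subgroup.center G : Set G) = {g : G | g ^ 2 = 1} ∧ (Subgroup.center G).index = 4) := by
  by_cases hab : ∀ x y, F.c x y = 0
  · left
    rw [isMulCommutative_subgroup_iff]
    exact fun a _ b _ => (F.c_eq_zero a b).1 (hab a b)
  push Not at hab
  obtain ⟨x, y, hxy⟩ := hab
  by_cases hrank : ∀ x y z, F.c x y ≠ 0 → F.c x z = 0 ∨ F.c x z = F.c x y
  · rcases F.elementary_or_center hxy hrank with h | h
    · exact .inr (.inl h)
    · exact .inr (.inr (.inr h))
  · push Not at hrank
    obtain ⟨x, y, z, hs, ht, hst⟩ := hrank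
    obtain ⟨y, z, hs, ht, hst, hyz⟩ := F.exists_commuting hs ht hst
    rcases F.closure_or_elementary_or_orderOf_four hs ht hst hyz with h | h | h
    · exact .inl h
    · exact .inr (.inl h)
    · exact .inr (.inr (.inl h))

end SquareCommutatorForm

/-! ### Central squares: sign characters and the quadratic condition. -/

section CentralSquares

open MonoidAlgebra (single)

variable {G : Type*} [Group G]

/-- The central elements of order at most two. -/
def centralInvolutions (G : Type*) [Group G] : Subgroup G where
  carrier := {t | t ∈ Subgroup.center G ∧ t ^ 2 = 1}
  one_mem' := ⟨one_mem _, one_pow 2⟩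
  mul_mem' := fun {a b} ha hb => ⟨mul_mem ha.1 hb.1, by
    rw [Commute.mul_pow (Subgroup.mem_center_iff.1 hb.1 a), ha.2, hb.2, one_mul]⟩
  inv_mem' := fun {a} ha => ⟨inv_mem ha.1, by rw [inv_pow, ha.2, inv_one]⟩

theorem centralInvolutions_comm {t : G} (ht : t ∈ centralInvolutions G) (g : G) :
    g * t = t * g := Subgroup.mem_center_iff.1 ht.1 g

theorem centralInvolutions_mul_self {t : G} (ht : t ∈ centralInvolutions G) : t * t = 1 := by
  rw [← pow_two, ht.2]

instance : CommGroup (centralInvolutions G) :=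
  { (inferInstance : Group (centralInvolutions G)) with
    mul_comm := fun a b => Subtype.ext (centralInvolutions_comm b.2 a) }

noncomputable instance : Module (ZMod 2) (Additive (centralInvolutions G)) :=
  AddCommGroup.zmodModule fun x => by
    have : (x.toMul) ^ 2 = 1 := Subtype.ext x.toMul.2.2
    exact congrArg Additive.ofMul this

/-- A commutator is a product of three squares. -/
theorem commutator_mem_centralInvolutions (hsq : ∀ g : G, g ^ 2 ∈ centralInvolutions G) (x y : G) :
    x * y * x⁻¹ * y⁻¹ ∈ centralInvolutions G := by
  have : x * y * x⁻¹ * y⁻¹ = (x * y) ^ 2 * ((y⁻¹ * x⁻¹ * y) ^ 2 * (y⁻¹) ^ 2) := by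
    simp only [pow_two]; group
  rw [this]
  exact mul_mem (hsq _) (mul_mem (hsq _) (hsq _))

open Classical in
/-- A sign character of the central involutions, extended by zero to the whole group. -/
noncomputable def signWeight (χ : Additive (centralInvolutions G) →ₗ[ZMod 2] ZMod 2) (g : G) : ℤ :=
  if h : g ∈ centralInvolutions G then (if χ (Additive.ofMul ⟨g, h⟩) = 0 then 1 else -1) else 0

theorem signWeight_of_mem (χ : Additive (centralInvolutions G) →ₗ[ZMod 2] ZMod 2) {g : G}
    (h : g ∈ centralInvolutions G) :
    signWeight χ g = if χ (Additive.ofMul ⟨g, h⟩) = 0 then 1 else -1 := dif_pos h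

theorem signWeight_mul (χ : Additive (centralInvolutions G) →ₗ[ZMod 2] ZMod 2) {t : G}
    (ht : t ∈ centralInvolutions G) (g : G) :
    signWeight χ (t * g) = signWeight χ t * signWeight χ g := by
  by_cases hg : g ∈ centralInvolutions G
  · rw [signWeight_of_mem χ (mul_mem ht hg), signWeight_of_mem χ hg, signWeight_of_mem χ ht]
    have : Additive.ofMul (⟨t * g, mul_mem ht hg⟩ : centralInvolutions G) =
      Additive.ofMul ⟨t, ht⟩ + Additive.ofMul ⟨g, hg⟩ := rfl
    rw [this, map_add]
    rcases zmod_two_eq_zero_or_one (χ (Additive.ofMul ⟨t, ht⟩)) with h1 | h1 <;>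
      rcases zmod_two_eq_zero_or_one (χ (Additive.ofMul ⟨g, hg⟩)) with h2 | h2 <;>
      simp [h1, h2, show (1 : ZMod 2) + 1 = 0 from rfl]
  · have hz : ∀ k, k ∉ centralInvolutions G → signWeight χ k = 0 := fun k hk => dif_neg hk
    rw [hz g hg, hz (t * g) (fun h => hg ((Subgroup.mul_mem_cancel_left _ ht).1 h)), mul_zero]

/-- The integral linear form on the group ring which extends a sign character of the central
involutions by zero. -/
noncomputable def signForm (χ : Additive (centralInvolutions G) →ₗ[ZMod 2] ZMod 2) :
    MonoidAlgebra ℤ G →+ ℤ :=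
  (Finsupp.liftAddHom fun g => AddMonoidHom.mulLeft (signWeight χ g)).comp
    (MonoidAlgebra.coeffAddEquiv : MonoidAlgebra ℤ G ≃+ (G →₀ ℤ)).toAddMonoidHom

theorem signForm_single (χ : Additive (centralInvolutions G) →ₗ[ZMod 2] ZMod 2) (g : G) (r : ℤ) :
    signForm χ (single g r) = signWeight χ g * r :=
  Finsupp.liftAddHom_apply_single (fun g => AddMonoidHom.mulLeft (signWeight χ g)) g r

theorem signForm_single_mul (χ : Additive (centralInvolutions G) →ₗ[ZMod 2] ZMod 2) {t : G}
    (ht : t ∈ centralInvolutions G) (x : MonoidAlgebra ℤ G) :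
    signForm χ (single t 1 * x) = signWeight χ t * signForm χ x := by
  induction x using MonoidAlgebra.induction_linear with
  | zero => simp
  | add a b ha hb => rw [mul_add, map_add, ha, hb, map_add, mul_add]
  | single g r =>
    rw [MonoidAlgebra.single_mul_single, one_mul, signForm_single, signForm_single,
      signWeight_mul χ ht, mul_assoc]

/-- Commutator of two `q`-commuting elements with central coefficients. -/
theorem lie_mul_central {A : Type*} [Ring A] {a b γ α β : A} (hba : b * a = a * b * γ)
    (hα : ∀ x, x * α = α * x) (hβ : ∀ x, x * β = β * x) :
    a * α * (b * β) - b * β * (a * α) = a * b * ((1 - γ) * (α * β)) := by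
  have h1 : a * α * (b * β) = a * b * (α * β) := by
    rw [mul_assoc, ← mul_assoc α, ← hα b]; simp only [mul_assoc]
  have h2 : b * β * (a * α) = b * a * (α * β) := by
    rw [mul_assoc, ← mul_assoc β, ← hβ a, mul_assoc a, ← mul_assoc b, hα β]
  rw [h1, h2, hba, sub_mul, mul_sub, one_mul, mul_assoc (a * b)]

theorem signForm_one_sub_mul (χ : Additive (centralInvolutions G) →ₗ[ZMod 2] ZMod 2) {t : G}
    (ht : t ∈ centralInvolutions G) (h : signWeight χ t = -1) (x : MonoidAlgebra ℤ G) :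
    signForm χ ((1 - .single t 1) * x) = 2 * signForm χ x := by
  rw [sub_mul, one_mul, map_sub, signForm_single_mul χ ht, h]; ring

theorem signForm_one_add_mul (χ : Additive (centralInvolutions G) →ₗ[ZMod 2] ZMod 2) {t : G}
    (ht : t ∈ centralInvolutions G) (h : signWeight χ t = 1) (x : MonoidAlgebra ℤ G) :
    signForm χ ((1 + .single t 1) * x) = 2 * signForm χ x := by
  rw [add_mul, one_mul, map_add, signForm_single_mul χ ht, h]; ring

/-- The basic symmetric element `x + x⁻¹` of the group ring. -/
noncomputable def addInv (R : Type*) [CommRing R] (x : G) : MonoidAlgebra R G :=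
  single x 1 + single x⁻¹ 1

theorem addInv_mem_symmetricElements (R : Type*) [CommRing R] (x : G) :
    addInv R x ∈ symmetricElements R G := by
  rw [addInv, mem_symmetricElements, classicalInvolution_add, classicalInvolution_single,
    classicalInvolution_single, inv_inv, add_comm]

/-- x⁴ = 1, so x⁻¹ = x · x² and the second factor is central. -/
theorem addInv_eq (R : Type*) [CommRing R] {x : G} (hx : x ^ 2 ∈ centralInvolutions G) :
    addInv R x = single x 1 * (1 + single (x ^ 2) 1) := by
  have h4 : x * x ^ 3 = 1 := by
    rw [← pow_succ', show 3 + 1 = 2 * 2 from rfl, pow_mul, hx.2]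
  rw [addInv, mul_add, mul_one, MonoidAlgebra.single_mul_single, one_mul, ← pow_succ',
    inv_eq_of_mul_eq_one_right h4]

theorem single_mem_center {R : Type*} [CommRing R] {t : G} (ht : t ∈ centralInvolutions G) :
    (single t 1 : MonoidAlgebra R G) ∈ Subring.center (MonoidAlgebra R G) :=
  Subring.mem_center_iff.2 fun x =>
    (MonoidAlgebra.single_commute (fun g => (centralInvolutions_comm ht g).symm)
      (fun _ => Commute.all _ _) x).eq.symm

theorem one_add_single_mem_center {R : Type*} [CommRing R] {t : G}
    (ht : t ∈ centralInvolutions G) :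
    (1 + single t 1 : MonoidAlgebra R G) ∈ Subring.center (MonoidAlgebra R G) :=
  add_mem (one_mem _) (single_mem_center ht)

theorem one_sub_single_mem_center {R : Type*} [CommRing R] {t : G}
    (ht : t ∈ centralInvolutions G) :
    (1 - single t 1 : MonoidAlgebra R G) ∈ Subring.center (MonoidAlgebra R G) :=
  sub_mem (one_mem _) (single_mem_center ht)

/-- The commutator of two basic symmetric elements in a group with central squares of order two. -/
theorem lie_addInv {R : Type*} [CommRing R]
    {x y c : G} (hx : x ^ 2 ∈ centralInvolutions G) (hy : y ^ 2 ∈ centralInvolutions G)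
    (hyx : y * x = x * y * c) :
    ⁅addInv R x, addInv R y⁆ =
      single (x * y) 1 * ((1 - single c 1) * ((1 + single (x ^ 2) 1) * (1 + single (y ^ 2) 1))) := by
  rw [addInv_eq R hx, addInv_eq R hy, Ring.lie_def,
    lie_mul_central (γ := single c 1) _ (Subring.mem_center_iff.1 (one_add_single_mem_center hx))
      (Subring.mem_center_iff.1 (one_add_single_mem_center hy)),
    MonoidAlgebra.single_mul_single, one_mul]
  simp only [MonoidAlgebra.single_mul_single, one_mul, hyx]

/-- The obstruction to being Lie metabelian coming from three products of two elements. -/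
theorem not_sign_of_isLieMetabelian (hM : IsLieMetabelian (symmetricElements ℤ G))
    (hsq : ∀ g : G, g ^ 2 ∈ centralInvolutions G)
    (χ : Additive (centralInvolutions G) →ₗ[ZMod 2] ZMod 2) {x y z w c d e : G}
    (hc : c ∈ centralInvolutions G) (hd : d ∈ centralInvolutions G) (he : e ∈ centralInvolutions G)
    (hyx : y * x = x * y * c) (hwz : w * z = z * w * d)
    (hzw : z * w * (x * y) = x * y * (z * w) * e)
    (hχc : signWeight χ c = -1) (hχd : signWeight χ d = -1) (hχe : signWeight χ e = -1)
    (hχx : signWeight χ (x ^ 2) = 1) (hχy : signWeight χ (y ^ 2) = 1)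
    (hχz : signWeight χ (z ^ 2) = 1) (hχw : signWeight χ (w ^ 2) = 1) : False := by
  have h := hM _ (addInv_mem_symmetricElements ℤ x) _ (addInv_mem_symmetricElements ℤ y) _
    (addInv_mem_symmetricElements ℤ z) _ (addInv_mem_symmetricElements ℤ w)
  rw [lie_addInv (hsq x) (hsq y) hyx, lie_addInv (hsq z) (hsq w) hwz, Ring.lie_def,
    lie_mul_central (γ := single e 1)
      (by simp only [MonoidAlgebra.single_mul_single, one_mul, hzw])
      (Subring.mem_center_iff.1 (mul_mem (one_sub_single_mem_center hc)
        (mul_mem (one_add_single_mem_center (hsq x)) (one_add_single_mem_center (hsq y)))))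
      (Subring.mem_center_iff.1 (mul_mem (one_sub_single_mem_center hd)
        (mul_mem (one_add_single_mem_center (hsq z)) (one_add_single_mem_center (hsq w))))),
    MonoidAlgebra.single_mul_single, one_mul] at h
  -- After the group part is cancelled, `signForm χ` extracts a factor 2 from each of the seven
  -- central factors, so ±2⁷ = 0. The trailing 1 lets the last factor act on something.
  replace h := congrArg (fun v => signForm χ (single (x * y * (z * w))⁻¹ 1 * v * 1)) h
  simp only [mul_zero, zero_mul, map_zero] at h
  rw [← mul_assoc, MonoidAlgebra.single_mul_single, inv_mul_cancel, one_mul,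
    ← MonoidAlgebra.one_def, one_mul] at h
  simp only [mul_assoc] at h
  rw [signForm_one_sub_mul χ he hχe, signForm_one_sub_mul χ hc hχc,
    signForm_one_add_mul χ (hsq x) hχx, signForm_one_add_mul χ (hsq y) hχy,
    signForm_one_sub_mul χ hd hχd, signForm_one_add_mul χ (hsq z) hχz,
    signForm_one_add_mul χ (hsq w) hχw, MonoidAlgebra.one_def, signForm_single,
    signWeight_of_mem χ (one_mem _)] at h
  split_ifs at h <;> omega

theorem mul_swap_of_sq_mem (hsq : ∀ g : G, g ^ 2 ∈ centralInvolutions G) (x y : G) :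
    y * x = x * y * (x * y * x⁻¹ * y⁻¹) := by
  have hc := commutator_mem_centralInvolutions hsq x y
  rw [centralInvolutions_comm hc]
  nth_rw 1 [← one_mul (y * x), ← centralInvolutions_mul_self hc]
  group

/-- The square of an element, as a vector of the `ZMod 2`-space of central involutions. -/
def sqClass (hsq : ∀ g : G, g ^ 2 ∈ centralInvolutions G) (g : G) :
    Additive (centralInvolutions G) :=
  Additive.ofMul ⟨g ^ 2, hsq g⟩

/-- The commutator of two elements, as a vector of the `ZMod 2`-space of central involutions. -/
def commClass (hsq : ∀ g : G, g ^ 2 ∈ centralInvolutions G) (x y : G) :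
    Additive (centralInvolutions G) :=
  Additive.ofMul ⟨x * y * x⁻¹ * y⁻¹, commutator_mem_centralInvolutions hsq x y⟩

theorem commClass_mul_right (hsq : ∀ g : G, g ^ 2 ∈ centralInvolutions G) (x y z : G) :
    commClass hsq x (y * z) = commClass hsq x y + commClass hsq x z := by
  rw [commClass, commClass, commClass, ← ofMul_mul]
  refine congrArg Additive.ofMul (Subtype.ext ?_)
  change x * (y * z) * x⁻¹ * (y * z)⁻¹ = x * y * x⁻¹ * y⁻¹ * (x * z * x⁻¹ * z⁻¹)
  have := centralInvolutions_comm (commutator_mem_centralInvolutions hsq x z) (y⁻¹)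
  rw [mul_assoc (x * y * x⁻¹), this]
  group

theorem commClass_comm (hsq : ∀ g : G, g ^ 2 ∈ centralInvolutions G) (x y : G) :
    commClass hsq x y = commClass hsq y x := by
  refine congrArg Additive.ofMul (Subtype.ext ?_)
  change x * y * x⁻¹ * y⁻¹ = y * x * y⁻¹ * x⁻¹
  rw [eq_comm, ← inv_inj,
    inv_eq_of_mul_eq_one_right (centralInvolutions_mul_self
      (commutator_mem_centralInvolutions hsq x y))]
  group

theorem commClass_eq_zero (hsq : ∀ g : G, g ^ 2 ∈ centralInvolutions G) (x y : G) :
    commClass hsq x y = 0 ↔ x * y = y * x := by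
  rw [commClass, ofMul_eq_zero, ← Subtype.coe_inj]
  change x * y * x⁻¹ * y⁻¹ = 1 ↔ _
  rw [mul_inv_eq_one, mul_inv_eq_iff_eq_mul]

theorem sqClass_mul (hsq : ∀ g : G, g ^ 2 ∈ centralInvolutions G) (x y : G) :
    sqClass hsq (x * y) = sqClass hsq x + sqClass hsq y + commClass hsq x y := by
  rw [commClass, sqClass, sqClass, sqClass, ← ofMul_mul, ← ofMul_mul]
  refine congrArg Additive.ofMul (Subtype.ext ?_)
  change (x * y) ^ 2 = x ^ 2 * y ^ 2 * (x * y * x⁻¹ * y⁻¹)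
  have hc := centralInvolutions_comm (commutator_mem_centralInvolutions hsq x y)
  have : (x * y) ^ 2 = x * (y * x) * y := by rw [pow_two]; group
  rw [this, mul_swap_of_sq_mem hsq x y]
  generalize x * y * x⁻¹ * y⁻¹ = c at hc ⊢
  rw [mul_assoc (x ^ 2), hc (y ^ 2), mul_assoc x y c, hc y]
  simp only [pow_two, mul_assoc]

theorem signWeight_eq_one (χ : Additive (centralInvolutions G) →ₗ[ZMod 2] ZMod 2) {t : G}
    (ht : t ∈ centralInvolutions G) (h : χ (Additive.ofMul ⟨t, ht⟩) = 0) : signWeight χ t = 1 := by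
  rw [signWeight_of_mem χ ht, if_pos h]

theorem signWeight_eq_neg_one (χ : Additive (centralInvolutions G) →ₗ[ZMod 2] ZMod 2) {t : G}
    (ht : t ∈ centralInvolutions G) (h : χ (Additive.ofMul ⟨t, ht⟩) = 1) :
    signWeight χ t = -1 := by
  rw [signWeight_of_mem χ ht, if_neg (by rw [h]; exact one_ne_zero)]

/-- If χ(q g) = 1, then x and y can be corrected by g to a, b with χ ∘ q = 0; then [[a, b], [a,
abg]], formed from the basic symmetric elements, is detected by χ. -/
theorem dual_sqClass_eq_zero_of_orthogonal (hM : IsLieMetabelian (symmetricElements ℤ G))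
    (hsq : ∀ g : G, g ^ 2 ∈ centralInvolutions G)
    (χ : Additive (centralInvolutions G) →ₗ[ZMod 2] ZMod 2) (x y g : G)
    (hxy : χ (commClass hsq x y) = 1) (hxg : χ (commClass hsq x g) = 0)
    (hyg : χ (commClass hsq y g) = 0) : χ (sqClass hsq g) = 0 := by
  by_contra hg
  replace hg := (zmod_two_eq_zero_or_one _).resolve_left hg
  have hself : ∀ x, commClass hsq x x = 0 := fun x => (commClass_eq_zero hsq x x).2 rfl
  have hleft : ∀ x y z, commClass hsq (x * y) z = commClass hsq x z + commClass hsq y z :=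
    fun x y z => by
      rw [commClass_comm, commClass_mul_right, commClass_comm hsq z x, commClass_comm hsq z y]
  have e11 : (1 : ZMod 2) + 1 = 0 := rfl
  have adjust : ∀ x, χ (commClass hsq x g) = 0 → ∃ x', χ (sqClass hsq x') = 0 ∧
      χ (commClass hsq x' g) = 0 ∧ ∀ z, χ (commClass hsq z g) = 0 →
        χ (commClass hsq x' z) = χ (commClass hsq x z) := fun x hx => by
    rcases zmod_two_eq_zero_or_one (χ (sqClass hsq x)) with h | h
    · exact ⟨x, h, hx, fun _ _ => rfl⟩
    · refine ⟨x * g, ?_, ?_, fun z hz => ?_⟩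
      · rw [sqClass_mul, map_add, map_add, h, hg, hx, e11, zero_add]
      · rw [hleft, map_add, hx, hself, map_zero, zero_add]
      · rw [hleft, map_add, commClass_comm hsq g z, hz, add_zero]
  obtain ⟨a, ha, hag, hax⟩ := adjust x hxg
  obtain ⟨b, hb, hbg, hby⟩ := adjust y hyg
  have hab : χ (commClass hsq a b) = 1 := by
    rw [hax b hbg, commClass_comm, hby x hxg, commClass_comm, hxy]
  have hba : χ (commClass hsq b a) = 1 := by rw [commClass_comm, hab]
  -- The 1 from the commutator of a and b cancels the 1 from the square of g.
  have hw : χ (sqClass hsq (a * b * g)) = 0 := by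
    simp only [sqClass_mul, hleft, map_add, ha, hb, hab, hg, hag, hbg, zero_add, add_zero, e11]
  have haw : χ (commClass hsq a (a * b * g)) = 1 := by
    simp only [commClass_mul_right, hself, map_add, hab, hag, zero_add, add_zero]
  have hbw : χ (commClass hsq b (a * b * g)) = 1 := by
    simp only [commClass_mul_right, hself, map_add, hba, hbg, add_zero]
  have he : χ (commClass hsq (a * b) (a * (a * b * g))) = 1 := by
    rw [commClass_mul_right, hleft, hleft]
    simp only [map_add, hself, hba, haw, hbw, e11, zero_add, add_zero]
  exact not_sign_of_isLieMetabelian hM hsq χ (commutator_mem_centralInvolutions hsq _ _)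
    (commutator_mem_centralInvolutions hsq _ _) (commutator_mem_centralInvolutions hsq _ _)
    (mul_swap_of_sq_mem hsq a b) (mul_swap_of_sq_mem hsq a (a * b * g))
    (mul_swap_of_sq_mem hsq (a * b) (a * (a * b * g)))
    (signWeight_eq_neg_one χ _ hab) (signWeight_eq_neg_one χ _ haw) (signWeight_eq_neg_one χ _ he)
    (signWeight_eq_one χ _ ha) (signWeight_eq_one χ _ hb) (signWeight_eq_one χ _ ha)
    (signWeight_eq_one χ _ hw)

/-- The square-commutator form of a group with central squares of order two whose integral group
ring has Lie metabelian symmetric elements. -/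
def squareCommutatorForm (hM : IsLieMetabelian (symmetricElements ℤ G))
    (hsq : ∀ g : G, g ^ 2 ∈ centralInvolutions G) :
    SquareCommutatorForm G (Additive (centralInvolutions G)) where
  q := sqClass hsq
  c := commClass hsq
  c_mul_right := commClass_mul_right hsq
  c_comm := commClass_comm hsq
  c_eq_zero := commClass_eq_zero hsq
  q_mul := sqClass_mul hsq
  q_eq_zero x := by
    rw [sqClass, ofMul_eq_zero, ← Subtype.coe_inj]
    rfl
  conj_eq_inv x y h := by
    have h1 : y ^ 2 = x * y * x⁻¹ * y⁻¹ := congrArg Subtype.val (Additive.ofMul.injective h)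
    have h2 : y ^ 2 * y ^ 2 = 1 := centralInvolutions_mul_self (hsq y)
    have : x * y * x⁻¹ = y ^ 2 * y := by rw [h1]; group
    rw [this, eq_inv_iff_mul_eq_one, mul_assoc, ← pow_two, h2]
  quad := dual_sqClass_eq_zero_of_orthogonal hM hsq

theorem group_alternatives_of_isLieMetabelian (hM : IsLieMetabelian (symmetricElements ℤ G)) :
    IsMulCommutative (Subgroup.closure {g : G | g ^ 2 ≠ 1}) ∨
      (∃ E : Subgroup G, E.index = 2 ∧ IsMulCommutative E ∧ ∀ e ∈ E, e ^ 2 = 1) ∨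
      (∃ B : Subgroup G, B.index = 2 ∧ IsMulCommutative B ∧
        ∃ x : G, orderOf x = 4 ∧ ∀ b ∈ B, x⁻¹ * b * x = b⁻¹) ∨
      ((Subgroup.center G : Set G) = {g : G | g ^ 2 = 1} ∧ (Subgroup.center G).index = 4) := by
  by_cases h4 : ∀ g : G, g ^ 4 = 1
  · exact (squareCommutatorForm hM fun g => ⟨Subgroup.mem_center_iff.2 fun h =>
      (sq_mul_comm_of_pow_four_eq_one hM (h4 g) h).symm, by rw [← pow_mul]; exact h4 g⟩).classification
  · push Not at h4
    obtain ⟨g, hg⟩ := h4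
    rcases closure_or_orderOf_four_of_pow_four_ne_one (fun g hg => conj_eq_or_eq_inv hM hg)
      (fun g hg => sq_mul_comm_of_pow_four_eq_one hM hg) hg with h | h
    · exact .inl h
    · exact .inr (.inr (.inl h))

/-- Being Lie metabelian descends from the symmetric elements over a ring of characteristic zero to
the integral ones. -/
theorem isLieMetabelian_int_of_charZero (R : Type*) [CommRing R] [CharZero R]
    (hM : IsLieMetabelian (symmetricElements R G)) : IsLieMetabelian (symmetricElements ℤ G) := by
  set f := MonoidAlgebra.mapRingHom G (Int.castRingHom R) with hf
  have hinj : Function.Injective f := MonoidAlgebra.map_injective _ (by exact Int.cast_injective)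
  have hsym : ∀ a ∈ symmetricElements ℤ G, f a ∈ symmetricElements R G := fun a ha => by
    rw [mem_symmetricElements] at ha ⊢
    ext g
    rw [classicalInvolution_coeff, hf, MonoidAlgebra.coeff_mapRingHom,
      MonoidAlgebra.coeff_mapRingHom, ← classicalInvolution_coeff, ha]
  intro a ha b hb c hc d hd
  apply hinj
  rw [map_zero, ← hM _ (hsym a ha) _ (hsym b hb) _ (hsym c hc) _ (hsym d hd)]
  simp only [Ring.lie_def, map_sub, map_mul]

end CentralSquares

/-! ### Sufficiency of the first three conditions. -/

section Converse

open MonoidAlgebra (single)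

variable {R G : Type*} [CommRing R] [Group G]

open Classical in
/-- The basic symmetric element attached to a group element. -/
noncomputable def basicSymmetric (R : Type*) [CommRing R] (g : G) : MonoidAlgebra R G :=
  if g ^ 2 = 1 then single g 1 else addInv R g

theorem basicSymmetric_of_sq_eq_one {g : G} (h : g ^ 2 = 1) :
    basicSymmetric R g = single g 1 := if_pos h

theorem basicSymmetric_of_sq_ne_one {g : G} (h : g ^ 2 ≠ 1) :
    basicSymmetric R g = addInv R g := if_neg h

theorem basicSymmetric_mem_symmetricElements (g : G) :
    basicSymmetric R g ∈ symmetricElements R G := by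
  by_cases h : g ^ 2 = 1
  · rw [basicSymmetric_of_sq_eq_one h, mem_symmetricElements, classicalInvolution_single,
      inv_eq_of_mul_eq_one_right (by rw [← pow_two, h])]
  · rw [basicSymmetric_of_sq_ne_one h]; exact addInv_mem_symmetricElements R g

/-- Subtracting x(g) times the basic element of g removes g and g⁻¹ from the support of x; induct on
its size. -/
theorem symmetricElements_subset_span :
    symmetricElements R G ⊆ Submodule.span R (Set.range (basicSymmetric (G := G) R)) := by
  classical
  suffices H : ∀ n, ∀ x ∈ symmetricElements R G, x.coeff.support.card = n →
      x ∈ Submodule.span R (Set.range (basicSymmetric (G := G) R)) from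
    fun x hx => H _ x hx rfl
  intro n
  induction n using Nat.strong_induction_on with
  | _ n ih =>
    rintro x hx rfl
    by_cases h0 : x = 0
    · rw [h0]; exact zero_mem _
    obtain ⟨g, hg⟩ : ∃ g, x.coeff g ≠ 0 := by
      by_contra! h
      exact h0 (by ext g; simpa using h g)
    set b := basicSymmetric R g
    have hb : b ∈ symmetricElements R G := basicSymmetric_mem_symmetricElements g
    have hginv : x.coeff g⁻¹ = x.coeff g := by
      rw [← classicalInvolution_coeff, mem_symmetricElements.1 hx]
    have hbg : b.coeff g = 1 := by
      by_cases h : g ^ 2 = 1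
      · simp [b, basicSymmetric_of_sq_eq_one h]
      · have : g⁻¹ ≠ g := fun e => h (by rw [pow_two]; nth_rw 1 [← e]; simp)
        simp [b, basicSymmetric_of_sq_ne_one h, addInv, this]
    have hbs : ∀ k, k ≠ g → k ≠ g⁻¹ → b.coeff k = 0 := fun k h1 h2 => by
      by_cases h : g ^ 2 = 1
      · simp [b, basicSymmetric_of_sq_eq_one h, h1.symm]
      · simp [b, basicSymmetric_of_sq_ne_one h, addInv, h1.symm, h2.symm]
    have hy : x - x.coeff g • b ∈ symmetricElements R G := by
      rw [mem_symmetricElements] at *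
      rw [classicalInvolution_sub, classicalInvolution_smul, hx, hb]
    have hcard : (x - x.coeff g • b).coeff.support.card < x.coeff.support.card := by
      apply Finset.card_lt_card
      refine Finset.ssubset_iff_of_subset ?_ |>.2 ⟨g, Finsupp.mem_support_iff.2 hg, ?_⟩
      · intro k hk
        rw [Finsupp.mem_support_iff] at hk ⊢
        contrapose! hk
        by_cases h1 : k = g
        · exact absurd (h1 ▸ hk) hg
        by_cases h2 : k = g⁻¹
        · rw [h2, hginv] at hk; exact absurd hk hg
        simp [hbs k h1 h2, hk]
      · simp [hbg]
    have := ih _ hcard _ hy rfl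
    rw [← sub_add_cancel x (x.coeff g • b)]
    exact add_mem this (Submodule.smul_mem _ _ (Submodule.subset_span ⟨g, rfl⟩))

/-- It suffices to check the Lie metabelian identity on a spanning set, through a set containing
all commutators of the spanning set. -/
theorem isLieMetabelian_of_basicSymmetric (K : Set (MonoidAlgebra R G))
    (hK : ∀ g h : G, ⁅basicSymmetric R g, basicSymmetric R h⁆ ∈ K)
    (hcomm : ∀ k ∈ K, ∀ l ∈ K, k * l = l * k) : IsLieMetabelian (symmetricElements R G) := by
  set S := Submodule.span R (Set.range (basicSymmetric (G := G) R))
  have h1 : ∀ a ∈ S, ∀ b ∈ S, ⁅a, b⁆ ∈ Submodule.span R K := by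
    intro a ha b hb
    induction ha using Submodule.span_induction with
    | zero => rw [Ring.lie_def, zero_mul, mul_zero, sub_zero]; exact zero_mem _
    | add x y _ _ hx hy =>
      have : ⁅x + y, b⁆ = ⁅x, b⁆ + ⁅y, b⁆ := by simp only [Ring.lie_def]; noncomm_ring
      rw [this]; exact add_mem hx hy
    | smul r x _ hx =>
      have : ⁅r • x, b⁆ = r • ⁅x, b⁆ := by
        simp only [Ring.lie_def, smul_sub, smul_mul_assoc, mul_smul_comm]
      rw [this]; exact Submodule.smul_mem _ _ hx
    | mem x hx =>
      obtain ⟨g, rfl⟩ := hx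
      induction hb using Submodule.span_induction with
      | zero => rw [Ring.lie_def, zero_mul, mul_zero, sub_zero]; exact zero_mem _
      | add x y _ _ hx hy =>
        have : ⁅basicSymmetric R g, x + y⁆ = ⁅basicSymmetric R g, x⁆ + ⁅basicSymmetric R g, y⁆ := by
          simp only [Ring.lie_def]; noncomm_ring
        rw [this]; exact add_mem hx hy
      | smul r x _ hx =>
        have : ⁅basicSymmetric R g, r • x⁆ = r • ⁅basicSymmetric R g, x⁆ := by
          simp only [Ring.lie_def, smul_sub, smul_mul_assoc, mul_smul_comm]
        rw [this]; exact Submodule.smul_mem _ _ hx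
      | mem x hx =>
        obtain ⟨h, rfl⟩ := hx
        exact Submodule.subset_span (hK g h)
  have h2 : ∀ k ∈ Submodule.span R K, ∀ l ∈ Submodule.span R K, k * l = l * k := by
    intro k hk l hl
    induction hk using Submodule.span_induction with
    | zero => simp
    | add x y _ _ hx hy => rw [add_mul, mul_add, hx, hy]
    | smul r x _ hx => rw [smul_mul_assoc, mul_smul_comm, hx]
    | mem x hx =>
      induction hl using Submodule.span_induction with
      | zero => simp
      | add y z _ _ hy hz => rw [add_mul, mul_add, hy, hz]
      | smul r y _ hy => rw [smul_mul_assoc, mul_smul_comm, hy]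
      | mem y hy => exact hcomm x hx y hy
  intro a ha b hb c hc d hd
  rw [Ring.lie_def, h2 _ (h1 a (symmetricElements_subset_span ha) b (symmetricElements_subset_span hb))
    _ (h1 c (symmetricElements_subset_span hc) d (symmetricElements_subset_span hd)), sub_self]

/-- The elements of the group ring supported on a subset of the group. -/
noncomputable def supportedOn (R : Type*) [CommRing R] {S : Type*} (X : Set S) :
    Submodule R (MonoidAlgebra R S) :=
  Submodule.span R ((fun g => single g 1) '' X)

theorem single_mem_supportedOn {S : Type*} {X : Set S} {g : S} (hg : g ∈ X) :
    (single g 1 : MonoidAlgebra R S) ∈ supportedOn R X :=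
  Submodule.subset_span ⟨g, hg, rfl⟩

theorem mul_mem_supportedOn {X Y Z : Set G} (h : ∀ x ∈ X, ∀ y ∈ Y, x * y ∈ Z)
    {a b : MonoidAlgebra R G} (ha : a ∈ supportedOn R X) (hb : b ∈ supportedOn R Y) :
    a * b ∈ supportedOn R Z := by
  induction ha using Submodule.span_induction with
  | zero => rw [zero_mul]; exact zero_mem _
  | add x y _ _ hx hy => rw [add_mul]; exact add_mem hx hy
  | smul r x _ hx => rw [smul_mul_assoc]; exact Submodule.smul_mem _ _ hx
  | mem x hx =>
    obtain ⟨g, hg, rfl⟩ := hx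
    induction hb using Submodule.span_induction with
    | zero => rw [mul_zero]; exact zero_mem _
    | add x y _ _ hx hy => rw [mul_add]; exact add_mem hx hy
    | smul r x _ hx => rw [mul_smul_comm]; exact Submodule.smul_mem _ _ hx
    | mem x hx =>
      obtain ⟨k, hk, rfl⟩ := hx
      simp only [MonoidAlgebra.single_mul_single, one_mul]
      exact single_mem_supportedOn (h g hg k hk)

theorem mul_comm_of_mem_supportedOn {X Y : Set G} (h : ∀ x ∈ X, ∀ y ∈ Y, x * y = y * x)
    {a b : MonoidAlgebra R G} (ha : a ∈ supportedOn R X) (hb : b ∈ supportedOn R Y) :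
    a * b = b * a := by
  induction ha using Submodule.span_induction with
  | zero => simp
  | add x y _ _ hx hy => rw [add_mul, mul_add, hx, hy]
  | smul r x _ hx => rw [smul_mul_assoc, mul_smul_comm, hx]
  | mem x hx =>
    obtain ⟨g, hg, rfl⟩ := hx
    induction hb using Submodule.span_induction with
    | zero => simp
    | add x y _ _ hx hy => rw [mul_add, add_mul, hx, hy]
    | smul r x _ hx => rw [mul_smul_comm, smul_mul_assoc, hx]
    | mem x hx =>
      obtain ⟨k, hk, rfl⟩ := hx
      simp only [MonoidAlgebra.single_mul_single, h g hg k hk]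

theorem involution_eq_self_of_mem_supportedOn {X : Set G} (h : ∀ x ∈ X, x ^ 2 = 1)
    {a : MonoidAlgebra R G} (ha : a ∈ supportedOn R X) : classicalInvolution R G a = a := by
  induction ha using Submodule.span_induction with
  | zero => exact classicalInvolution_zero
  | add x y _ _ hx hy => rw [classicalInvolution_add, hx, hy]
  | smul r x _ hx => rw [classicalInvolution_smul, hx]
  | mem x hx =>
    obtain ⟨g, hg, rfl⟩ := hx
    rw [classicalInvolution_single, inv_eq_of_mul_eq_one_right (by rw [← pow_two, h g hg])]

theorem basicSymmetric_mem_supportedOn {X : Set G} {g : G} (hg : g ∈ X) (hg' : g⁻¹ ∈ X) :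
    basicSymmetric R g ∈ supportedOn R X := by
  by_cases h : g ^ 2 = 1
  · rw [basicSymmetric_of_sq_eq_one h]; exact single_mem_supportedOn hg
  · rw [basicSymmetric_of_sq_ne_one h]
    exact add_mem (single_mem_supportedOn hg) (single_mem_supportedOn hg')

theorem basicSymmetric_inv (g : G) : basicSymmetric R g⁻¹ = basicSymmetric R g := by
  by_cases h : g ^ 2 = 1
  · rw [inv_eq_of_mul_eq_one_right (by rw [← pow_two, h])]
  · rw [basicSymmetric_of_sq_ne_one h, basicSymmetric_of_sq_ne_one (by simpa using h), addInv,
      addInv, inv_inv, add_comm]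

theorem basicSymmetric_conj (x g : G) :
    single x 1 * basicSymmetric R g * single x⁻¹ 1 = basicSymmetric R (x * g * x⁻¹) := by
  by_cases h : g ^ 2 = 1
  · rw [basicSymmetric_of_sq_eq_one h, basicSymmetric_of_sq_eq_one (by rw [conj_pow, h]; simp)]
    simp [MonoidAlgebra.single_mul_single]
  · rw [basicSymmetric_of_sq_ne_one h,
      basicSymmetric_of_sq_ne_one (by rw [conj_pow]; simpa using h), addInv, addInv]
    simp [mul_add, add_mul, MonoidAlgebra.single_mul_single, mul_assoc]

/-- Conjugation permutes basic symmetric elements, and g and g⁻¹ share theirs. -/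
theorem basicSymmetric_comm {g : G} (h : ∀ x : G, x * g * x⁻¹ = g ∨ x * g * x⁻¹ = g⁻¹)
    (a : MonoidAlgebra R G) : basicSymmetric R g * a = a * basicSymmetric R g := by
  induction a using MonoidAlgebra.induction_linear with
  | zero => simp
  | add a b ha hb => rw [mul_add, add_mul, ha, hb]
  | single x r =>
    have h1 : single x 1 * basicSymmetric R g * single x⁻¹ 1 = basicSymmetric R g := by
      rw [basicSymmetric_conj]
      rcases h x with h | h
      · rw [h]
      · rw [h, basicSymmetric_inv]
    have h2 : basicSymmetric R g * single x 1 = single x 1 * basicSymmetric R g := by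
      nth_rw 1 [← h1]
      rw [mul_assoc, MonoidAlgebra.single_mul_single, inv_mul_cancel, one_mul,
        ← MonoidAlgebra.one_def, mul_one]
    have h3 : (single x r : MonoidAlgebra R G) = r • single x 1 := by simp
    rw [h3, mul_smul_comm, smul_mul_assoc, h2]

/-- Basic elements from B are central, so a nonzero commutator involves two elements outside B and
is supported on the commutative B. -/
theorem isLieMetabelian_of_normalized {B : Subgroup G} (hB : IsMulCommutative B)
    (hindex : ∀ g, g ∉ B → ∀ h, h ∉ B → g * h ∈ B)
    (hconj : ∀ b ∈ B, ∀ x : G, x * b * x⁻¹ = b ∨ x * b * x⁻¹ = b⁻¹) :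
    IsLieMetabelian (symmetricElements R G) := by
  rw [isMulCommutative_subgroup_iff] at hB
  refine isLieMetabelian_of_basicSymmetric (supportedOn R (B : Set G)) (fun g h => ?_)
    fun k hk l hl => mul_comm_of_mem_supportedOn hB hk hl
  by_cases hg : g ∈ B
  · rw [Ring.lie_def, basicSymmetric_comm (hconj g hg), sub_self]; exact zero_mem _
  by_cases hh : h ∈ B
  · rw [Ring.lie_def, basicSymmetric_comm (hconj h hh), sub_self]; exact zero_mem _
  have hmem : ∀ g, g ∉ B → basicSymmetric R g ∈ supportedOn R {x | x ∉ B} := fun g hg =>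
    basicSymmetric_mem_supportedOn hg (by simpa using hg)
  rw [Ring.lie_def]
  exact sub_mem (mul_mem_supportedOn hindex (hmem g hg) (hmem h hh))
    (mul_mem_supportedOn hindex (hmem h hh) (hmem g hg))

/-- For g outside A and a in A, both g and ga are involutions, so g inverts A. A product of two
outside elements centralizes A, so it lies in A unless G has exponent 2, when G is abelian. -/
theorem isLieMetabelian_of_closure
    (hA : IsMulCommutative (Subgroup.closure {g : G | g ^ 2 ≠ 1})) :
    IsLieMetabelian (symmetricElements R G) := by
  set A := Subgroup.closure {g : G | g ^ 2 ≠ 1} with hAdef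
  have hcomm := isMulCommutative_subgroup_iff.1 hA
  have hout : ∀ g, g ∉ A → g * g = 1 := fun g hg => by
    by_contra h
    exact hg (Subgroup.subset_closure (by rwa [Set.mem_ofPred_eq, pow_two]))
  have hinv : ∀ g, g ∉ A → ∀ a ∈ A, g * a * g⁻¹ = a⁻¹ := fun g hg a ha => by
    have h := hout (g * a) fun h => hg (by simpa using mul_mem h (inv_mem ha))
    rw [inv_eq_of_mul_eq_one_right (hout g hg), eq_inv_iff_mul_eq_one, ← h]
    group
  have hnorm : ∀ b ∈ A, ∀ x : G, x * b * x⁻¹ = b ∨ x * b * x⁻¹ = b⁻¹ := fun b hb x => by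
    by_cases hx : x ∈ A
    · left; rw [hcomm x hx b hb, mul_inv_cancel_right]
    · exact .inr (hinv x hx b hb)
  by_cases hsq : ∃ a : G, a ^ 2 ≠ 1
  · obtain ⟨a, ha⟩ := hsq
    have haA : a ∈ A := Subgroup.subset_closure ha
    refine isLieMetabelian_of_normalized hA (fun g hg h hh => ?_) hnorm
    by_contra hgh
    have h1 := hinv _ hgh a haA
    have h2 : g * h * a * (g * h)⁻¹ = g * (h * a * h⁻¹) * g⁻¹ := by group
    rw [h2, hinv h hh a haA, hinv g hg _ (inv_mem haA), inv_inv, eq_inv_iff_mul_eq_one, ← pow_two]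
      at h1
    exact ha h1
  · push Not at hsq
    have htop : ∀ g h : G, g * h = h * g := fun g h => by
      have e : ∀ g : G, g⁻¹ = g := fun g => inv_eq_of_mul_eq_one_right (by rw [← pow_two, hsq])
      rw [← e (g * h), mul_inv_rev, e, e]
    exact isLieMetabelian_of_normalized (B := ⊤) (isMulCommutative_subgroup_iff.2
      fun a _ b _ => htop a b) (fun g hg => absurd (Subgroup.mem_top g) hg)
      fun b _ x => .inl (by rw [htop x b, mul_inv_cancel_right])

/-- Order 4 keeps x out of B, for inside B it would equal its inverse; then every element of the
other coset inverts B. -/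
theorem isLieMetabelian_of_inverted {B : Subgroup G} (hi : B.index = 2) (hB : IsMulCommutative B)
    {x : G} (hx : orderOf x = 4) (hinv : ∀ b ∈ B, x⁻¹ * b * x = b⁻¹) :
    IsLieMetabelian (symmetricElements R G) := by
  have hcomm := isMulCommutative_subgroup_iff.1 hB
  have hxB : x ∉ B := fun h => by
    have h1 := hinv x h
    rw [inv_mul_cancel, one_mul, eq_inv_iff_mul_eq_one, ← pow_two] at h1
    have := orderOf_dvd_of_pow_eq_one h1
    rw [hx] at this
    omega
  have hinv' : ∀ b ∈ B, x * b * x⁻¹ = b⁻¹ := fun b hb => by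
    have := hinv _ (inv_mem hb)
    rw [inv_inv] at this
    nth_rw 1 [← this]
    group
  refine isLieMetabelian_of_normalized hB
    (fun g hg h hh => (Subgroup.mul_mem_iff_of_index_two hi).2 (by simp [hg, hh])) fun b hb g => ?_
  by_cases hg : g ∈ B
  · left; rw [hcomm g hg b hb, mul_inv_cancel_right]
  · right
    have hgx : g * x⁻¹ ∈ B := (Subgroup.mul_mem_iff_of_index_two hi).2 (by simp [hg, hxB])
    have : g * b * g⁻¹ = g * x⁻¹ * (x * b * x⁻¹) * (g * x⁻¹)⁻¹ := by group
    rw [this, hinv' b hb, hcomm _ hgx _ (inv_mem hb), mul_inv_cancel_right]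

/-- Commutators k, l of basic elements are skew and supported off E, so kl is supported on E and
fixed by *: kl = (kl)* = l*k* = lk. -/
theorem isLieMetabelian_of_elementary {E : Subgroup G} (hi : E.index = 2)
    (hE : IsMulCommutative E) (hsq : ∀ e ∈ E, e ^ 2 = 1) :
    IsLieMetabelian (symmetricElements R G) := by
  have hcomm := isMulCommutative_subgroup_iff.1 hE
  have hprod : ∀ a ∈ supportedOn R {x : G | x ∉ E}, ∀ b ∈ supportedOn R {x : G | x ∉ E},
      classicalInvolution R G (a * b) = a * b := fun a ha b hb =>
    involution_eq_self_of_mem_supportedOn hsq (mul_mem_supportedOn (Z := (E : Set G))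
      (fun g hg h hh => (Subgroup.mul_mem_iff_of_index_two hi).2 (by simp_all)) ha hb)
  have hmem : ∀ g, g ∉ E → basicSymmetric R g ∈ supportedOn R {x | x ∉ E} := fun g hg =>
    basicSymmetric_mem_supportedOn hg (by simpa using hg)
  have hmemE : ∀ g, g ∈ E → basicSymmetric R g ∈ supportedOn R (E : Set G) := fun g hg =>
    basicSymmetric_mem_supportedOn hg (inv_mem hg)
  have hskew : ∀ g h : G, classicalInvolution R G ⁅basicSymmetric R g, basicSymmetric R h⁆ =
      -⁅basicSymmetric R g, basicSymmetric R h⁆ := fun g h => by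
    rw [Ring.lie_def, classicalInvolution_sub, classicalInvolution_mul, classicalInvolution_mul,
      basicSymmetric_mem_symmetricElements g, basicSymmetric_mem_symmetricElements h, neg_sub]
  have hl : ∀ x ∈ (E : Set G), ∀ y ∈ {x : G | x ∉ E}, x * y ∈ {x : G | x ∉ E} :=
    fun x hx y hy h => hy ((Subgroup.mul_mem_cancel_left E hx).1 h)
  have hr : ∀ x ∈ {x : G | x ∉ E}, ∀ y ∈ (E : Set G), x * y ∈ {x : G | x ∉ E} :=
    fun x hx y hy h => hx ((Subgroup.mul_mem_cancel_right E hy).1 h)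
  refine isLieMetabelian_of_basicSymmetric
    {k | k ∈ supportedOn R {x : G | x ∉ E} ∧ classicalInvolution R G k = -k}
    (fun g h => ⟨?_, hskew g h⟩) fun k hk l hl => ?_
  · rw [Ring.lie_def]
    by_cases hg : g ∈ E <;> by_cases hh : h ∈ E
    · rw [mul_comm_of_mem_supportedOn hcomm (hmemE g hg) (hmemE h hh), sub_self]
      exact zero_mem _
    · exact sub_mem (mul_mem_supportedOn hl (hmemE g hg) (hmem h hh))
        (mul_mem_supportedOn hr (hmem h hh) (hmemE g hg))
    · exact sub_mem (mul_mem_supportedOn hr (hmem g hg) (hmemE h hh))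
        (mul_mem_supportedOn hl (hmemE h hh) (hmem g hg))
    · have := hprod _ (hmem g hg) _ (hmem h hh)
      rw [classicalInvolution_mul, basicSymmetric_mem_symmetricElements g,
        basicSymmetric_mem_symmetricElements h] at this
      rw [this, sub_self]
      exact zero_mem _
  · have := hprod k hk.1 l hl.1
    rw [classicalInvolution_mul, hk.2, hl.2, neg_mul_neg] at this
    exact this.symm

end Converse

/-! ### Sufficiency of the condition on the center. -/

section CenterOfIndexFour

open MonoidAlgebra (single)

variable {R G : Type*} [CommRing R] [Group G]

/-- Since x and y do not commute, 1, x, y, xy lie in distinct cosets of the center, hence exhaust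
them. -/
theorem coset_cases_of_center_index_four (h4 : (Subgroup.center G).index = 4) {x y : G}
    (hxy : x * y ≠ y * x) (g : G) : ∃ z ∈ Subgroup.center G,
      g = z ∨ g = x * z ∨ g = y * z ∨ g = x * y * z := by
  classical
  have hfin : Finite (G ⧸ Subgroup.center G) :=
    Nat.finite_of_card_ne_zero (by change (Subgroup.center G).index ≠ 0; omega)
  have := Fintype.ofFinite (G ⧸ Subgroup.center G)
  have key : ∀ a b : G, (a : G ⧸ Subgroup.center G) = b → ∃ z ∈ Subgroup.center G, b = a * z :=
    fun a b h => ⟨a⁻¹ * b, QuotientGroup.eq.1 h, by group⟩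
  have comm : ∀ z ∈ Subgroup.center G, ∀ a, a * z = z * a := fun z hz a =>
    Subgroup.mem_center_iff.1 hz a
  have hx : (1 : G ⧸ Subgroup.center G) ≠ x := fun h => by
    obtain ⟨z, hz, e⟩ := key 1 x h
    rw [one_mul] at e
    exact hxy (by rw [e, comm z hz])
  have hy : (1 : G ⧸ Subgroup.center G) ≠ y := fun h => by
    obtain ⟨z, hz, e⟩ := key 1 y h
    rw [one_mul] at e
    exact hxy (by rw [e, comm z hz])
  have hne : (x : G ⧸ Subgroup.center G) ≠ y := fun h => by
    obtain ⟨z, hz, e⟩ := key x y h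
    exact hxy (by rw [e, mul_assoc, comm z hz])
  have hmul : (1 : G ⧸ Subgroup.center G) ≠ x * y := fun h => by
    obtain ⟨z, hz, e⟩ := key 1 (x * y) h
    rw [one_mul, ← eq_inv_mul_iff_mul_eq] at e
    exact hxy (by rw [e, mul_inv_cancel_left, mul_assoc, ← comm z hz x, inv_mul_cancel_left])
  set X := (x : G ⧸ Subgroup.center G)
  set Y := (y : G ⧸ Subgroup.center G)
  have hcard : ({1, X, Y, X * Y} : Finset (G ⧸ Subgroup.center G)).card =
      Fintype.card (G ⧸ Subgroup.center G) := by
    rw [← Nat.card_eq_fintype_card]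
    change _ = (Subgroup.center G).index
    rw [h4, Finset.card_insert_of_notMem, Finset.card_insert_of_notMem,
      Finset.card_insert_of_notMem, Finset.card_singleton]
    · simpa using hx.symm
    · simpa [hne] using hy.symm
    · simp [hx, hy, hmul]
  have hg : (g : G ⧸ Subgroup.center G) ∈
      ({1, X, Y, X * Y} : Finset (G ⧸ Subgroup.center G)) := by
    rw [(Finset.card_eq_iff_eq_univ _).1 hcard]; exact Finset.mem_univ _
  simp only [Finset.mem_insert, Finset.mem_singleton] at hg
  rcases hg with h | h | h | h
  · obtain ⟨z, hz, e⟩ := key 1 g h.symm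
    exact ⟨z, hz, .inl (by rw [e, one_mul])⟩
  · obtain ⟨z, hz, e⟩ := key x g h.symm
    exact ⟨z, hz, .inr (.inl e)⟩
  · obtain ⟨z, hz, e⟩ := key y g h.symm
    exact ⟨z, hz, .inr (.inr (.inl e))⟩
  · obtain ⟨z, hz, e⟩ := key (x * y) g h.symm
    exact ⟨z, hz, .inr (.inr (.inr e))⟩

theorem sq_mem_center_of_index_four (h4 : (Subgroup.center G).index = 4) (g : G) :
    g ^ 2 ∈ Subgroup.center G := by
  by_contra h
  have hg : ∃ y, g * y ≠ y * g := by
    by_contra! hc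
    exact h (pow_mem (Subgroup.mem_center_iff.2 fun y => (hc y).symm) 2)
  obtain ⟨y, hy⟩ := hg
  obtain ⟨z, hz, e | e | e | e⟩ := coset_cases_of_center_index_four h4 hy (g ^ 2)
  · exact h (e ▸ hz)
  · rw [pow_two, mul_right_inj] at e
    rw [e] at h
    exact h (pow_mem hz 2)
  · have := Subgroup.mem_center_iff.1 (inv_mem hz)
    have e' : y = g ^ 2 * z⁻¹ := by rw [e]; group
    apply hy
    rw [e', mul_assoc, ← this g, ← mul_assoc, ← mul_assoc, ← pow_succ', ← pow_succ]
  · have := Subgroup.mem_center_iff.1 (inv_mem hz)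
    have e' : y = g * z⁻¹ := by
      have : g * (y * z) = g * g := by rw [← mul_assoc, ← e, pow_two]
      rw [← (mul_right_inj g).1 this]; group
    apply hy
    rw [e', mul_assoc, this g]

/-- (1 + x)x = 1 + x and likewise for y, so xyc acts as c, and (1 - c)(1 + c) = 0. -/
theorem one_sub_mul_one_add_eq_zero {A : Type*} [CommRing A] {c x y : A} (hc : c * c = 1)
    (hx : x * x = 1) (hy : y * y = 1) :
    (1 - c) * ((1 + x) * (1 + y)) * (1 + x * y * c) = 0 := by
  linear_combination (y * c - y * c * c + y * y * c - y * y * c * c) * hx +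
    (c + x * c - c * c - x * c * c) * hy - (1 + x + y + x * y) * hc

theorem single_obstruction_eq_zero {c x y : G} (hc : c ∈ centralInvolutions G)
    (hx : x ∈ centralInvolutions G) (hy : y ∈ centralInvolutions G) :
    (1 - single c 1) * ((1 + single x 1) * (1 + single y 1)) * (1 + single (x * y * c) 1) =
      (0 : MonoidAlgebra R G) := by
  have hsq : ∀ (t : G) (ht : t ∈ centralInvolutions G),
      (⟨single t 1, single_mem_center ht⟩ * ⟨single t 1, single_mem_center ht⟩ :
        Subring.center (MonoidAlgebra R G)) = 1 := fun t ht => Subtype.ext (by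
    change (single t 1 * single t 1 : MonoidAlgebra R G) = 1
    rw [MonoidAlgebra.single_mul_single, centralInvolutions_mul_self ht, one_mul,
      MonoidAlgebra.one_def])
  have := congrArg Subtype.val (one_sub_mul_one_add_eq_zero (hsq c hc) (hsq x hx) (hsq y hy))
  have e : (single (x * y * c) 1 : MonoidAlgebra R G) = single x 1 * single y 1 * single c 1 := by
    simp only [MonoidAlgebra.single_mul_single, one_mul]
  rw [e]
  exact this

/-- For noncommuting x, y and z, w: if z or w lies in the coset of xy, its square is x²y²c and the
central factors multiply to 0. Otherwise z and w occupy the cosets of x and y, so zw is xy times a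
central element. -/
theorem isLieMetabelian_of_center_index_four
    (hz : (Subgroup.center G : Set G) = {g : G | g ^ 2 = 1})
    (h4 : (Subgroup.center G).index = 4) : IsLieMetabelian (symmetricElements R G) := by
  have hcen : ∀ g, g ∈ Subgroup.center G ↔ g ^ 2 = 1 := fun g => by
    rw [← SetLike.mem_coe, hz]; rfl
  have hT : ∀ g, g ∈ Subgroup.center G → g ∈ centralInvolutions G := fun g hg =>
    ⟨hg, (hcen g).1 hg⟩
  have hsq : ∀ g : G, g ^ 2 ∈ centralInvolutions G := fun g =>
    hT _ (sq_mem_center_of_index_four h4 g)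
  have hlie0 : ∀ x y : G, x * y = y * x → ⁅basicSymmetric R x, basicSymmetric R y⁆ = 0 := by
    intro x y hxy
    have hm : ∀ x : G, basicSymmetric R x ∈ supportedOn R {x, x⁻¹} := fun x =>
      basicSymmetric_mem_supportedOn (by simp) (by simp)
    rw [Ring.lie_def, mul_comm_of_mem_supportedOn _ (hm x) (hm y), sub_self]
    have hC : Commute x y := hxy
    rintro a (rfl | rfl) b (rfl | rfl)
    · exact hC
    · exact hC.inv_right
    · exact hC.inv_left
    · exact hC.inv_inv
  have hb : ∀ x y : G, x * y ≠ y * x → basicSymmetric R x = addInv R x ∧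
      basicSymmetric R y = addInv R y := fun x y hxy =>
    ⟨basicSymmetric_of_sq_ne_one fun h => hxy
      (Subgroup.mem_center_iff.1 ((hcen x).2 h) y).symm,
     basicSymmetric_of_sq_ne_one fun h => hxy (Subgroup.mem_center_iff.1 ((hcen y).2 h) x)⟩
  refine isLieMetabelian_of_basicSymmetric
    {k | ∃ x y : G, k = ⁅basicSymmetric R x, basicSymmetric R y⁆} (fun g h => ⟨g, h, rfl⟩) ?_
  rintro _ ⟨x, y, rfl⟩ _ ⟨z, w, rfl⟩
  by_cases hxy : x * y = y * x
  · rw [hlie0 x y hxy, zero_mul, mul_zero]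
  by_cases hzw : z * w = w * z
  · rw [hlie0 z w hzw, zero_mul, mul_zero]
  rw [(hb x y hxy).1, (hb x y hxy).2, (hb z w hzw).1, (hb z w hzw).2,
    lie_addInv (hsq x) (hsq y) (mul_swap_of_sq_mem hsq x y),
    lie_addInv (hsq z) (hsq w) (mul_swap_of_sq_mem hsq z w)]
  set c := x * y * x⁻¹ * y⁻¹
  set d := z * w * z⁻¹ * w⁻¹
  have hc : c ∈ centralInvolutions G := commutator_mem_centralInvolutions hsq x y
  have hd : d ∈ centralInvolutions G := commutator_mem_centralInvolutions hsq z w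
  have hA : (1 - single c 1) * ((1 + single (x ^ 2) 1) * (1 + single (y ^ 2) 1)) ∈
      Subring.center (MonoidAlgebra R G) := mul_mem (one_sub_single_mem_center hc)
    (mul_mem (one_add_single_mem_center (hsq x)) (one_add_single_mem_center (hsq y)))
  have hB : (1 - single d 1) * ((1 + single (z ^ 2) 1) * (1 + single (w ^ 2) 1)) ∈
      Subring.center (MonoidAlgebra R G) := mul_mem (one_sub_single_mem_center hd)
    (mul_mem (one_add_single_mem_center (hsq z)) (one_add_single_mem_center (hsq w)))
  have hxysq : (x * y) ^ 2 = x ^ 2 * y ^ 2 * c := 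
    congrArg (fun v => ((Additive.toMul v : centralInvolutions G) : G)) (sqClass_mul hsq x y)
  have hsqz : ∀ g ∈ Subgroup.center G, (x * y * g) ^ 2 = x ^ 2 * y ^ 2 * c := fun g hg => by
    rw [Commute.mul_pow (Subgroup.mem_center_iff.1 hg _), (hcen g).1 hg, mul_one, hxysq]
  have hzero : ∀ g ∈ Subgroup.center G,
      (1 - single c 1) * ((1 + single (x ^ 2) 1) * (1 + single (y ^ 2) 1)) *
        (1 + single ((x * y * g) ^ 2) 1) = (0 : MonoidAlgebra R G) := fun g hg => by
    rw [hsqz g hg, single_obstruction_eq_zero hc (hsq x) (hsq y)]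
  have hAB : ∀ A ∈ Subring.center (MonoidAlgebra R G), ∀ B ∈ Subring.center (MonoidAlgebra R G),
      ((x * y) * (z * w) = (z * w) * (x * y) ∨ A * B = 0) →
      single (x * y) 1 * A * (single (z * w) 1 * B) =
        single (z * w) 1 * B * (single (x * y) 1 * A) := by
    intro A hA B hB h
    have hA := Subring.mem_center_iff.1 hA
    have hB := Subring.mem_center_iff.1 hB
    have e1 : single (x * y) 1 * A * (single (z * w) 1 * B) =
        single (x * y) 1 * single (z * w) 1 * (A * B) := by
      rw [mul_assoc, ← mul_assoc A, ← hA]; simp only [mul_assoc]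
    have e2 : single (z * w) 1 * B * (single (x * y) 1 * A) =
        single (z * w) 1 * single (x * y) 1 * (A * B) := by
      rw [mul_assoc, ← mul_assoc B, ← hB, mul_assoc _ B A, ← hB A]; simp only [mul_assoc]
    rw [e1, e2]
    rcases h with h | h
    · rw [MonoidAlgebra.single_mul_single, MonoidAlgebra.single_mul_single, h]
    · rw [h, mul_zero, mul_zero]
  apply hAB _ hA _ hB
  have hu : ∀ g : G, (1 + single (g ^ 2) 1 : MonoidAlgebra R G) ∈
      Subring.center (MonoidAlgebra R G) := fun g => one_add_single_mem_center (hsq g)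
  have cm : ∀ g ∈ Subgroup.center G, ∀ a, a * g = g * a := fun g hg a =>
    Subgroup.mem_center_iff.1 hg a
  by_cases hzc : ∃ g ∈ Subgroup.center G, z = x * y * g
  · right
    obtain ⟨g, hg, rfl⟩ := hzc
    rw [← mul_assoc _ _ (1 + single (w ^ 2) 1), Subring.mem_center_iff.1 (hu _) (1 - single d 1),
      mul_assoc _ _ (1 + single (w ^ 2) 1), ← mul_assoc, hzero g hg, zero_mul]
  by_cases hwc : ∃ g ∈ Subgroup.center G, w = x * y * g
  · right
    obtain ⟨g, hg, rfl⟩ := hwc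
    rw [← mul_assoc (1 - single d 1), Subring.mem_center_iff.1 (hu (x * y * g))
      ((1 - single d 1) * (1 + single (z ^ 2) 1)), ← mul_assoc, hzero g hg,
      zero_mul]
  left
  have central : ∀ g ∈ Subgroup.center G, ∀ a, Commute a g := fun g hg a => cm g hg a
  have hyx : y * x = x * y * c := mul_swap_of_sq_mem hsq x y
  obtain ⟨g, hg, ez⟩ := coset_cases_of_center_index_four h4 hxy z
  obtain ⟨h, hh, ew⟩ := coset_cases_of_center_index_four h4 hxy w
  rcases ez with rfl | rfl | rfl | ez
  · exact absurd (cm z hg w).symm hzw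
  · rcases ew with rfl | rfl | rfl | ew
    · exact absurd (cm w hh _) hzw
    · exact absurd (((Commute.refl x).mul_right (central h hh x)).mul_left
        ((central g hg (x * h)).symm)) hzw
    · have : x * g * (y * h) = x * y * (g * h) := by
        rw [mul_assoc x, ← mul_assoc g, ← cm g hg y]; simp only [mul_assoc]
      rw [this]
      exact (Commute.refl _).mul_right (central _ (mul_mem hg hh) _)
    · exact absurd ⟨h, hh, ew⟩ hwc
  · rcases ew with rfl | rfl | rfl | ew
    · exact absurd (cm w hh _) hzw
    · have : y * g * (x * h) = x * y * (c * (g * h)) := by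
        rw [mul_assoc y, ← mul_assoc g, ← cm g hg x, ← mul_assoc (x * y), ← hyx]
        simp only [mul_assoc]
      rw [this]
      exact (Commute.refl _).mul_right (central _ (mul_mem hc.1 (mul_mem hg hh)) _)
    · exact absurd (((Commute.refl y).mul_right (central h hh y)).mul_left
        ((central g hg (y * h)).symm)) hzw
    · exact absurd ⟨h, hh, ew⟩ hwc
  · exact absurd ⟨g, hg, ez⟩ hzc

end CenterOfIndexFour

theorem theorem1 (R G : Type*) [CommRing R] [CharZero R] [Group G] :
    IsLieMetabelian (symmetricElements R G) ↔
      IsMulCommutative (Subgroup.closure {g : G | g ^ 2 ≠ 1}) ∨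
      (∃ E : Subgroup G, E.index = 2 ∧ IsMulCommutative E ∧ ∀ e ∈ E, e ^ 2 = 1) ∨
      (∃ B : Subgroup G, B.index = 2 ∧ IsMulCommutative B ∧
        ∃ x : G, orderOf x = 4 ∧ ∀ b ∈ B, x⁻¹ * b * x = b⁻¹) ∨
      ((Subgroup.center G : Set G) = {g : G | g ^ 2 = 1} ∧ (Subgroup.center G).index = 4) := by
  constructor
  · intro hM
    exact group_alternatives_of_isLieMetabelian (isLieMetabelian_int_of_charZero R hM)
  · rintro (h | ⟨E, hi, hE, hsq⟩ | ⟨B, hi, hB, x, hx, hinv⟩ | ⟨hz, h4⟩)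
    · exact isLieMetabelian_of_closure h
    · exact isLieMetabelian_of_elementary hi hE hsq
    · exact isLieMetabelian_of_inverted hi hB hx hinv
    · exact isLieMetabelian_of_center_index_four hz h4
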